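/- Let $\Phi$ be an irreducible reduced crystallographic root system spanning a Euclidean space $\mathbb{R}^n$ with inner product $\langle\cdot,\cdot\rangle$ (for instance the root system of a compact simple Lie group $G$ of rank $n$), with simple roots $\Delta=\{\alpha_1,\dots,\alpha_n\}$, simple reflections $r_i a=a-\frac{2\langle a,\alpha_i\rangle}{\langle\alpha_i,\alpha_i\rangle}\alpha_i$, and dual roots $\alpha^\vee=2\alpha/\langle\alpha,\alpha\rangle$. Let $\xi$ be the highest root of $\Phi$ with respect to $\Delta$, and let $\eta$ be the highest root of the dual root system $\Phi^\vee=\{\alpha^\vee:\alpha\in\Phi\}$ with respect to $\Delta^\vee=\{\alpha_1^\vee,\dots,\alpha_n^\vee\}$. Put $$Q=\sum_i\mathbb{Z}\alpha_i,\quad Q^\vee=\sum_i\mathbb{Z}\alpha_i^\vee,\quad P=\{\omega\in\mathbb{R}^n:\langle\omega,\alpha_i^\vee\rangle\in\mathbb{Z}\ \forall i\},\quad P^\vee=\{\omega\in\mathbb{R}^n:\langle\omega,\alpha_i\rangle\in\mathbb{Z}\ \forall i\},$$ $$F=\{a\in\mathbb{R}^n:\langle a,\alpha_i\rangle\ge 0\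 \forall i,\ \langle a,\xi\rangle\le 1\},\qquad F^\vee=\{a\in\mathbb{R}^n:\langle a,\alpha_i^\vee\rangle\ge 0\ \forall i,\ \langle a,\eta\rangle\le 1\}.$$ Choose $j,j'\in\{1,\dots,n\}$ and set $$F^e=F\cup r_j(\operatorname{int}F),\qquad F^{e\vee}=F^\vee\cup r_{j'}(\operatorname{int}F^\vee).$$ Let $M\ge 1$ be an integer. Let $F^e_M$ be the set of cosets in $\frac1M P^\vee/Q^\vee$ that have a representative in $F^e$, and let $\Lambda^e_M$ be the set of cosets in $P/MQ$ that have a representative in $MF^{e\vee}$. Then both sets are finite and $$|F^e_M|=|\Lambda^e_M|.$$ -/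

import Mathlib

open scoped Pointwise

noncomputable section

namespace EvenGrid

variable {ι V : Type*} [NormedAddCommGroup V] [InnerProductSpace ℝ V] {P : RootPairing ι ℝ V V}

/-- A root system lives in a Euclidean space `V` if the pairing of `V` with itself is the inner
product of `V` and the coroot of each root `α` is `2α / ⟨α, α⟩`. -/
structure IsEuclidean (P : RootPairing ι ℝ V V) : Prop where
  pairing_eq_inner : ∀ x y : V, P.toLinearMap x y = inner ℝ x y
  coroot_eq : ∀ i : ι, P.coroot i = (2 / inner ℝ (P.root i) (P.root i)) • P.root i

/-- The root lattice `Q`, generated by the simple roots. -/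
def rootLattice (b : P.Base) : AddSubgroup V :=
  AddSubgroup.closure (P.root '' b.support)

/-- The dual root lattice `Q^∨`, generated by the simple dual roots. -/
def dualRootLattice (b : P.Base) : AddSubgroup V :=
  AddSubgroup.closure (P.coroot '' b.support)

/-- The weight lattice `P`: the vectors whose inner product with every simple dual root is an
integer. -/
def weightLattice (b : P.Base) : AddSubgroup V where
  carrier := {x | ∀ i ∈ b.support, ∃ k : ℤ, inner ℝ x (P.coroot i) = (k : ℝ)}
  zero_mem' := fun _ _ => ⟨0, by simp⟩
  add_mem' := fun {x y} hx hy i hi => by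
    obtain ⟨k, hk⟩ := hx i hi
    obtain ⟨l, hl⟩ := hy i hi
    exact ⟨k + l, by rw [inner_add_left, hk, hl]; push_cast; rfl⟩
  neg_mem' := fun {x} hx i hi => by
    obtain ⟨k, hk⟩ := hx i hi
    exact ⟨-k, by rw [inner_neg_left, hk]; push_cast; rfl⟩

/-- The dual weight lattice `P^∨`: the vectors whose inner product with every simple root is an
integer. -/
def dualWeightLattice (b : P.Base) : AddSubgroup V where
  carrier := {x | ∀ i ∈ b.support, ∃ k : ℤ, inner ℝ x (P.root i) = (k : ℝ)}
  zero_mem' := fun _ _ => ⟨0, by simp⟩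
  add_mem' := fun {x y} hx hy i hi => by
    obtain ⟨k, hk⟩ := hx i hi
    obtain ⟨l, hl⟩ := hy i hi
    exact ⟨k + l, by rw [inner_add_left, hk, hl]; push_cast; rfl⟩
  neg_mem' := fun {x} hx i hi => by
    obtain ⟨k, hk⟩ := hx i hi
    exact ⟨-k, by rw [inner_neg_left, hk]; push_cast; rfl⟩

/-- The (index of the) highest root `ξ`: a root of largest height, where the height of
`∑ cᵢ αᵢ` is `∑ cᵢ`. For an irreducible root system there is exactly one such root. -/
def highestRoot [Finite ι] [Nonempty ι] {P : RootPairing ι ℝ V V} (b : P.Base) : ι :=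
  (Finite.exists_max b.height).choose

/-- The (index of the) highest dual root `η`: the highest root of the dual root system, whose roots
are the coroots `α^∨` and whose simple roots are the simple dual roots. -/
def highestDualRoot [Finite ι] [Nonempty ι] (b : P.Base) : ι :=
  highestRoot b.flip

/-- The fundamental region `F` of the affine Weyl group. -/
def fundDomain [Finite ι] [Nonempty ι] (b : P.Base) : Set V :=
  {a | (∀ i ∈ b.support, 0 ≤ inner ℝ a (P.root i)) ∧ inner ℝ a (P.root (highestRoot b)) ≤ 1}

/-- The fundamental region `F^∨` of the dual affine Weyl group. -/
def dualFundDomain [Finite ι] [Nonempty ι] (b : P.Base) : Set V :=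
  {a | (∀ i ∈ b.support, 0 ≤ inner ℝ a (P.coroot i)) ∧
    inner ℝ a (P.coroot (highestDualRoot b)) ≤ 1}

/-- The set `F^e = F ∪ r_j (int F)`. -/
def evenFundDomain [Finite ι] [Nonempty ι] (b : P.Base) (j : ι) : Set V :=
  fundDomain b ∪ P.reflection j '' interior (fundDomain b)

/-- The set `F^{e∨} = F^∨ ∪ r_j (int F^∨)`. -/
def dualEvenFundDomain [Finite ι] [Nonempty ι] (b : P.Base) (j : ι) : Set V :=
  dualFundDomain b ∪ P.reflection j '' interior (dualFundDomain b)

/-- The lattice `(1/M) P^∨`. -/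
abbrev refinedLattice (b : P.Base) (M : ℕ) : AddSubgroup V :=
  ((M : ℝ)⁻¹) • dualWeightLattice b

/-- The group `((1/M) P^∨) / Q^∨`. -/
abbrev RefinedQuotient (b : P.Base) (M : ℕ) : Type _ :=
  refinedLattice b M ⧸ (dualRootLattice b).addSubgroupOf (refinedLattice b M)

/-- The group `P / MQ`. -/
abbrev WeightQuotient (b : P.Base) (M : ℕ) : Type _ :=
  weightLattice b ⧸ ((M : ℝ) • rootLattice b).addSubgroupOf (weightLattice b)

/-- The grid `F^e_M`: the cosets in `((1/M) P^∨) / Q^∨` with a representative in `F^e`. -/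
def pointGrid [Finite ι] [Nonempty ι] (b : P.Base) (j : ι) (M : ℕ) : Set (RefinedQuotient b M) :=
  {x | ∃ a : refinedLattice b M, (a : V) ∈ evenFundDomain b j ∧
    (QuotientAddGroup.mk a : RefinedQuotient b M) = x}

/-- The grid `Λ^e_M`: the cosets in `P / MQ` with a representative in `M F^{e∨}`. -/
def weightGrid [Finite ι] [Nonempty ι] (b : P.Base) (j : ι) (M : ℕ) : Set (WeightQuotient b M) :=
  {x | ∃ a : weightLattice b, (a : V) ∈ (M : ℝ) • dualEvenFundDomain b j ∧
    (QuotientAddGroup.mk a : WeightQuotient b M) = x}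

end EvenGrid

end

set_option linter.unusedSectionVars false

/-! Let `W` be the Weyl group and `G` its subgroup of determinant one. Both grids count orbits of
`G` on a finite group. `F` is a fundamental domain of `W ⋉ Q^∨`. The index-two subgroup `G ⋉ Q^∨`
needs one further copy of the interior of `F`, while boundary points need none, since a wall
reflection fixes them and corrects the determinant. So each orbit of `G ⋉ Q^∨` meets `F^e` exactly
once (`exists_map_add_mem_evenFundDomain`, `map_add_eq_self_of_mem_evenFundDomain`), and by
`ncard_cosetsMeeting` the grid `F^e_M` represents the `G`-orbits on `A = (1/M)P^∨/Q^∨`. Passing to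
`P.flip`, which has the same Weyl group, and scaling by `M`, the grid `Λ^e_M` represents the
`G`-orbits on `B = P/MQ`. The choices of `j` and `j'` play no role in the two orbit counts.

The inner product modulo 1 is a nondegenerate `W`-invariant pairing of `A` with `B`. Hence every `g`
fixes equally many points of `A` and of `B`, and Burnside's lemma equates the orbit counts
(`card_orbits_eq_of_pairing`).

That `F` is a fundamental domain is proved directly. It meets every orbit because the point of an
orbit nearest to an interior point of `F` lies in `F` (`exists_map_add_mem_fundDomain`). It meets an
orbit only once by the exchange condition for words in the simple affine reflections
(`affineWord_apply_eq_self`), which rests on the coefficientwise maximality of the highest root. -/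

namespace EvenGrid

/-! ### Orbit counting for finite abelian groups in duality -/

section Duality

variable {G A B : Type*} [Group G] [AddCommGroup A] [AddCommGroup B]
  [DistribMulAction G A] [DistribMulAction G B]

/-- The displacement homomorphism `a ↦ g • a - a`. -/
def displacement (A : Type*) [AddCommGroup A] [DistribMulAction G A] (g : G) : A →+ A :=
  DistribSMul.toAddMonoidHom A g - AddMonoidHom.id A

theorem displacement_apply (g : G) (a : A) : displacement A g a = g • a - a := rfl

/-- The fixed points of `g` are the kernel of `g⁻¹ - 1`, and an endomorphism of a finite group has
kernel and cokernel of equal order. -/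
theorem card_quotient_displacement_range [Finite A] (g : G) :
    Nat.card (A ⧸ (displacement A g⁻¹).range) = Nat.card (MulAction.fixedBy A g) := by
  have hker : ((displacement A g⁻¹).ker : Set A) = MulAction.fixedBy A g := by
    ext a
    simp only [SetLike.mem_coe, AddMonoidHom.mem_ker, displacement_apply, sub_eq_zero,
      MulAction.mem_fixedBy]
    rw [inv_smul_eq_iff, eq_comm]
  have h1 := (displacement A g⁻¹).range.card_eq_card_quotient_mul_card_addSubgroup
  have h2 := (displacement A g⁻¹).ker.card_eq_card_quotient_mul_card_addSubgroup
  have h3 : Nat.card (A ⧸ (displacement A g⁻¹).ker) = Nat.card (displacement A g⁻¹).range :=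
    Nat.card_congr (QuotientAddGroup.quotientKerEquivRange _).toEquiv
  have h4 : 0 < Nat.card (displacement A g⁻¹).range := Nat.card_pos
  have h5 : Nat.card (displacement A g⁻¹).ker = Nat.card (MulAction.fixedBy A g) := by
    rw [← hker]; rfl
  rw [← h5]
  refine Nat.eq_of_mul_eq_mul_right h4 ?_
  rw [← h1, h2, h3, mul_comm]

/-- If `g` fixes `b`, invariance gives `e (g⁻¹ • a) b = e a b`, so `e · b` is a character of the
cokernel of `g⁻¹ - 1` on `A`. Nondegeneracy makes `b` recoverable from it, and a finite abelian
group has as many characters as elements. -/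
theorem card_fixedBy_le_of_pairing [Finite A] (e : A →+ B →+ AddCircle (1 : ℝ))
    (he : ∀ (g : G) a b, e (g • a) (g • b) = e a b)
    (hB : ∀ b, (∀ a, e a b = 0) → b = 0) (g : G) :
    Nat.card (MulAction.fixedBy B g) ≤ Nat.card (MulAction.fixedBy A g) := by
  classical
  rw [← card_quotient_displacement_range (A := A)]
  have : Fintype (A ⧸ (displacement A g⁻¹).range) := Fintype.ofFinite _
  rw [Nat.card_eq_fintype_card (α := A ⧸ _), ← AddChar.card_eq, ← Nat.card_eq_fintype_card]
  have key (b : MulAction.fixedBy B g) : (displacement A g⁻¹).range ≤ (e.flip b.1).ker := by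
    rintro _ ⟨a, rfl⟩
    have h := he g (g⁻¹ • a) b.1
    rw [smul_inv_smul, b.2] at h
    simp [AddMonoidHom.mem_ker, displacement_apply, h]
  let χ (b : MulAction.fixedBy B g) : AddChar (A ⧸ (displacement A g⁻¹).range) ℂ :=
    Circle.coeHom.compAddChar
      (AddCircle.toCircle_addChar.compAddMonoidHom (QuotientAddGroup.lift _ (e.flip b.1) (key b)))
  refine Nat.card_le_card_of_injective χ fun b c hbc ↦ ?_
  refine Subtype.ext (sub_eq_zero.1 (hB _ fun a ↦ ?_))
  have h := DFunLike.congr_fun hbc (QuotientAddGroup.mk a)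
  have h' : e a b.1 = e a c.1 :=
    AddCircle.injective_toCircle (T := (1 : ℝ)) one_ne_zero (Circle.coe_injective h)
  rw [map_sub, h', sub_self]

/-- Two finite abelian groups in perfect equivariant duality have equally many orbits. -/
theorem card_orbits_eq_of_pairing [Finite G] [Finite A] [Finite B]
    (e : A →+ B →+ AddCircle (1 : ℝ))
    (he : ∀ (g : G) a b, e (g • a) (g • b) = e a b)
    (hA : ∀ a, (∀ b, e a b = 0) → a = 0) (hB : ∀ b, (∀ a, e a b = 0) → b = 0) :
    Nat.card (MulAction.orbitRel.Quotient G A) = Nat.card (MulAction.orbitRel.Quotient G B) := by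
  classical
  have := Fintype.ofFinite G
  have := Fintype.ofFinite A
  have := Fintype.ofFinite B
  have := Fintype.ofFinite (MulAction.orbitRel.Quotient G A)
  have := Fintype.ofFinite (MulAction.orbitRel.Quotient G B)
  have hAs := MulAction.sum_card_fixedBy_eq_card_orbits_mul_card_group G A
  have hBs := MulAction.sum_card_fixedBy_eq_card_orbits_mul_card_group G B
  have hfix (g : G) : Fintype.card (MulAction.fixedBy A g) =
      Fintype.card (MulAction.fixedBy B g) := by
    rw [← Nat.card_eq_fintype_card, ← Nat.card_eq_fintype_card]
    refine le_antisymm ?_ (card_fixedBy_le_of_pairing e he hB g)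
    exact card_fixedBy_le_of_pairing e.flip (fun g b a ↦ he g a b) hA g
  rw [Finset.sum_congr rfl fun g _ ↦ hfix g, hBs] at hAs
  rw [Nat.card_eq_fintype_card, Nat.card_eq_fintype_card]
  exact (Nat.eq_of_mul_eq_mul_right Fintype.card_pos hAs).symm

end Duality

/-! ### Group actions on lattice quotients and their orbit representatives -/

section QuotientAction

variable {G X : Type*} [Group G] [AddCommGroup X] [DistribMulAction G X] {L K : AddSubgroup X}

/-- The action on `L ⧸ (K ∩ L)` induced by an action that preserves `L` and `K`. -/
abbrev quotientAction (hL : ∀ (g : G), ∀ x ∈ L, g • x ∈ L) (hK : ∀ (g : G), ∀ x ∈ K, g • x ∈ K) :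
    DistribMulAction G (L ⧸ K.addSubgroupOf L) where
  smul g := QuotientAddGroup.map (K.addSubgroupOf L) (K.addSubgroupOf L)
    (((DistribSMul.toAddMonoidHom X g).comp L.subtype).codRestrict L fun x ↦ hL g x x.2)
    fun x hx ↦ hK g (x : X) hx
  one_smul := by
    rintro ⟨x⟩
    exact congrArg QuotientAddGroup.mk (Subtype.ext (one_smul G (x : X)))
  mul_smul := by
    rintro g h ⟨x⟩
    exact congrArg QuotientAddGroup.mk (Subtype.ext (mul_smul g h (x : X)))
  smul_zero g := map_zero _
  smul_add g := map_add _

/-- The cosets in `L ⧸ (K ∩ L)` with a representative in `S`. -/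
def cosetsMeeting (L K : AddSubgroup X) (S : Set X) : Set (L ⧸ K.addSubgroupOf L) :=
  {x | ∃ a : L, (a : X) ∈ S ∧ QuotientAddGroup.mk a = x}

theorem mk_eq_mk_iff {x y : L} :
    (QuotientAddGroup.mk x : L ⧸ K.addSubgroupOf L) = QuotientAddGroup.mk y ↔
      ∃ k ∈ K, (y : X) = x + k := by
  rw [QuotientAddGroup.eq, AddSubgroup.mem_addSubgroupOf]
  constructor
  · intro h
    exact ⟨_, h, by simp⟩
  · rintro ⟨k, hk, h⟩
    simpa [h] using hk

/-- If every orbit of `G ⋉ K` on `L` meets `S` in exactly one point then the cosets of `K` meeting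
`S` represent the orbits of `G` on `L ⧸ K`. -/
theorem ncard_cosetsMeeting (hL : ∀ (g : G), ∀ x ∈ L, g • x ∈ L)
    (hK : ∀ (g : G), ∀ x ∈ K, g • x ∈ K) (hKL : K ≤ L) {S : Set X}
    (hex : ∀ x ∈ L, ∃ g : G, ∃ k ∈ K, g • x + k ∈ S)
    (huniq : ∀ x ∈ S, ∀ g : G, ∀ k ∈ K, g • x + k ∈ S → g • x + k = x) :
    letI := quotientAction hL hK
    (cosetsMeeting L K S).ncard =
      Nat.card (MulAction.orbitRel.Quotient G (L ⧸ K.addSubgroupOf L)) := by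
  let := quotientAction hL hK
  have smul_mk (g : G) (x : L) : g • (QuotientAddGroup.mk x : L ⧸ K.addSubgroupOf L) =
    QuotientAddGroup.mk ⟨g • (x : X), hL g x x.2⟩ := rfl
  rw [← Nat.card_coe_set_eq]
  refine Nat.card_eq_of_bijective
    (fun x : cosetsMeeting L K S ↦ (Quotient.mk _ x.1 : MulAction.orbitRel.Quotient G _)) ⟨?_, ?_⟩
  · rintro ⟨_, x, hx, rfl⟩ ⟨_, y, hy, rfl⟩ h
    obtain ⟨g, hg⟩ : ∃ g : G, g • (QuotientAddGroup.mk y : L ⧸ K.addSubgroupOf L) =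
      QuotientAddGroup.mk x := Quotient.exact h
    rw [smul_mk, mk_eq_mk_iff] at hg
    obtain ⟨k, hk, hxy⟩ := hg
    have := huniq y hy g k hk (by rwa [← hxy])
    exact Subtype.ext (congrArg QuotientAddGroup.mk (Subtype.ext (hxy.trans this)))
  · rintro ⟨⟨x⟩⟩
    obtain ⟨g, k, hk, h⟩ := hex x x.2
    refine ⟨⟨_, ⟨_, L.add_mem (hL g x x.2) (hKL hk)⟩, h, rfl⟩, ?_⟩
    refine Quotient.sound ⟨g, ?_⟩
    change g • (QuotientAddGroup.mk x : L ⧸ K.addSubgroupOf L) = _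
    rw [smul_mk, mk_eq_mk_iff]
    exact ⟨k, hk, rfl⟩

/-- If `G` is finite and every orbit of `G ⋉ K` on `L` meets a finite set then `L ⧸ K` is
finite. -/
theorem finite_quotient_of_forall_exists [Finite G] (hL : ∀ (g : G), ∀ x ∈ L, g • x ∈ L)
    (hK : ∀ (g : G), ∀ x ∈ K, g • x ∈ K) (hKL : K ≤ L) {S : Set X}
    (hS : ((L : Set X) ∩ S).Finite) (hex : ∀ x ∈ L, ∃ g : G, ∃ k ∈ K, g • x + k ∈ S) :
    Finite (L ⧸ K.addSubgroupOf L) := by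
  have : Finite ↑((L : Set X) ∩ S) := hS
  refine Finite.of_surjective (fun p : G × ↑((L : Set X) ∩ S) ↦
    (QuotientAddGroup.mk ⟨p.1 • (p.2 : X), hL _ _ p.2.2.1⟩ : L ⧸ K.addSubgroupOf L)) ?_
  rintro ⟨x⟩
  obtain ⟨g, k, hk, h⟩ := hex x x.2
  refine ⟨(g⁻¹, ⟨_, L.add_mem (hL g x x.2) (hKL hk), h⟩), ?_⟩
  change _ = QuotientAddGroup.mk x
  rw [mk_eq_mk_iff]
  exact ⟨-(g⁻¹ • k), K.neg_mem (hK _ _ hk), by simp⟩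

end QuotientAction

/-! ### Coefficients of roots in the simple roots -/

section Coefficients

variable {ι V : Type*} [NormedAddCommGroup V] [InnerProductSpace ℝ V] {P : RootPairing ι ℝ V V}
  [P.IsRootSystem]

theorem repr_root_eq (b : P.Base) {i : ι} {f : ι → ℤ}
    (h : P.root i = ∑ j ∈ b.support, f j • P.root j) (j : b.support) :
    b.toWeightBasis.repr (P.root i) j = f j := by
  classical
  rw [h, ← Finset.sum_coe_sort]
  simp [map_sum, Finsupp.single_apply]

theorem height_eq_sum_repr (b : P.Base) (i : ι) :
    (b.height i : ℝ) = ∑ j : b.support, b.toWeightBasis.repr (P.root i) j := by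
  obtain ⟨f, -, -, hf⟩ := b.exists_root_eq_sum_int i
  rw [RootPairing.Base.height_eq_sum hf]
  simp_rw [repr_root_eq b hf]
  rw [Finset.sum_coe_sort b.support fun j ↦ (f j : ℝ)]
  push_cast
  rfl

theorem repr_root_nonneg_or_nonpos (b : P.Base) (i : ι) :
    (∀ j, 0 ≤ b.toWeightBasis.repr (P.root i) j) ∨ ∀ j, b.toWeightBasis.repr (P.root i) j ≤ 0 := by
  obtain ⟨f, -, hf, h⟩ := b.exists_root_eq_sum_int i
  simp_rw [repr_root_eq b h]
  exact hf.imp (fun hf j ↦ by exact_mod_cast hf.le (j : ι)) fun hf j ↦ by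
    exact_mod_cast hf.le (j : ι)

theorem isPos_iff_repr_nonneg (b : P.Base) (i : ι) :
    b.IsPos i ↔ ∀ j, 0 ≤ b.toWeightBasis.repr (P.root i) j := by
  constructor
  · intro hi
    rcases repr_root_nonneg_or_nonpos b i with h | h
    · exact h
    · have h0 : (b.height i : ℝ) ≤ 0 := by
        rw [height_eq_sum_repr]
        exact Finset.sum_nonpos fun j _ ↦ h j
      rw [RootPairing.Base.isPos_iff] at hi
      exact absurd h0 (by exact_mod_cast hi.not_ge)
  · intro h
    rw [RootPairing.Base.isPos_iff']
    have h0 : (0 : ℝ) ≤ b.height i := by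
      rw [height_eq_sum_repr]
      exact Finset.sum_nonneg fun j _ ↦ h j
    exact_mod_cast h0

theorem repr_root_nonpos (b : P.Base) {i : ι} (hi : ¬ b.IsPos i) (j : b.support) :
    b.toWeightBasis.repr (P.root i) j ≤ 0 :=
  ((repr_root_nonneg_or_nonpos b i).resolve_left fun h ↦
    hi ((isPos_iff_repr_nonneg b i).2 h)) j

theorem inner_eq_sum_repr (b : P.Base) (x y : V) :
    inner ℝ x y = ∑ j : b.support, b.toWeightBasis.repr y j * inner ℝ x (P.root j) := by
  conv_lhs => rw [← b.toWeightBasis.sum_repr y]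
  simp [inner_sum, inner_smul_right]

theorem inner_nonneg_of_repr_nonneg (b : P.Base) {x y : V}
    (hx : ∀ j ∈ b.support, 0 ≤ inner ℝ x (P.root j)) (hy : ∀ j, 0 ≤ b.toWeightBasis.repr y j) :
    0 ≤ inner ℝ x y := by
  rw [inner_eq_sum_repr b]
  exact Finset.sum_nonneg fun j _ ↦ mul_nonneg (hy j) (hx j j.2)

theorem eq_zero_of_inner_root_eq_zero (b : P.Base) {x : V}
    (hx : ∀ j ∈ b.support, inner ℝ x (P.root j) = 0) : x = 0 := by
  rw [← inner_self_eq_zero (𝕜 := ℝ), inner_eq_sum_repr b]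
  exact Finset.sum_eq_zero fun j _ ↦ by rw [hx j j.2, mul_zero]

theorem root_ext (b : P.Base) {x y : V}
    (h : ∀ j, b.toWeightBasis.repr x j = b.toWeightBasis.repr y j) : x = y :=
  b.toWeightBasis.repr.injective (Finsupp.ext h)

end Coefficients

/-! ### Euclidean root systems -/

namespace IsEuclidean

variable {ι V : Type*} [NormedAddCommGroup V] [InnerProductSpace ℝ V] {P : RootPairing ι ℝ V V}

theorem inner_root_self_pos (P : RootPairing ι ℝ V V) (i : ι) :
    0 < inner ℝ (P.root i) (P.root i) :=
  real_inner_self_pos.2 (P.ne_zero i)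

theorem inner_coroot (hP : IsEuclidean P) (x : V) (i : ι) :
    inner ℝ x (P.coroot i) =
      2 / inner ℝ (P.root i) (P.root i) * inner ℝ x (P.root i) := by
  rw [hP.coroot_eq, inner_smul_right]

theorem inner_root_coroot (hP : IsEuclidean P) [P.IsCrystallographic] (i j : ι) :
    inner ℝ (P.root i) (P.coroot j) = (P.pairingIn ℤ i j : ℝ) := by
  rw [← hP.pairing_eq_inner, P.root_coroot_eq_pairing, ← P.algebraMap_pairingIn ℤ]
  rfl

theorem pairingIn_eq (hP : IsEuclidean P) [P.IsCrystallographic] (i j : ι) :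
    (P.pairingIn ℤ i j : ℝ) =
      2 / inner ℝ (P.root j) (P.root j) * inner ℝ (P.root i) (P.root j) := by
  rw [← hP.inner_root_coroot, hP.inner_coroot]

theorem pairingIn_nonneg_iff (hP : IsEuclidean P) [P.IsCrystallographic] (i j : ι) :
    0 ≤ P.pairingIn ℤ i j ↔ 0 ≤ inner ℝ (P.root i) (P.root j) := by
  rw [← Int.cast_nonneg_iff (R := ℝ), hP.pairingIn_eq]
  exact mul_nonneg_iff_of_pos_left (div_pos two_pos (inner_root_self_pos P j))

theorem pairingIn_pos_iff (hP : IsEuclidean P) [P.IsCrystallographic] (i j : ι) :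
    0 < P.pairingIn ℤ i j ↔ 0 < inner ℝ (P.root i) (P.root j) := by
  rw [← Int.cast_pos (R := ℝ), hP.pairingIn_eq]
  exact mul_pos_iff_of_pos_left (div_pos two_pos (inner_root_self_pos P j))

/-- Exchanging root and coroot is harmless because they are proportional. This form has
displacements along coroots, the directions that generate `Q^∨`. -/
theorem reflection_apply (hP : IsEuclidean P) (i : ι) (x : V) :
    P.reflection i x = x - inner ℝ x (P.root i) • P.coroot i := by
  rw [P.reflection_apply]
  change x - P.toLinearMap x (P.coroot i) • P.root i = _
  rw [hP.pairing_eq_inner, hP.inner_coroot, hP.coroot_eq, smul_smul, mul_comm]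

theorem inner_coroot_root_self (hP : IsEuclidean P) (i : ι) :
    inner ℝ (P.coroot i) (P.root i) = 2 := by
  rw [real_inner_comm, ← hP.pairing_eq_inner, P.root_coroot_two]

theorem inner_reflection_left (hP : IsEuclidean P) (i : ι) (x y : V) :
    inner ℝ (P.reflection i x) y = inner ℝ x (P.reflection i y) := by
  rw [hP.reflection_apply, hP.reflection_apply, inner_sub_left, inner_sub_right, inner_smul_left,
    inner_smul_right, real_inner_comm y (P.coroot i), hP.inner_coroot, hP.inner_coroot]
  simp only [conj_trivial]
  ring

theorem inner_reflection_reflection (hP : IsEuclidean P) (i : ι) (x y : V) :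
    inner ℝ (P.reflection i x) (P.reflection i y) = inner ℝ x y := by
  rw [hP.inner_reflection_left, P.reflection_same]

/-- Hence a root system and its dual have the same Weyl group inside `V ≃ₗ[ℝ] V`, so one group acts
on both grids. -/
theorem coreflection_eq (hP : IsEuclidean P) (i : ι) : P.coreflection i = P.reflection i := by
  ext x
  rw [hP.reflection_apply, P.coreflection_apply]
  change x - P.toLinearMap (P.root i) x • P.coroot i = _
  rw [hP.pairing_eq_inner, real_inner_comm]

/-- Every result about `F`, `Q^∨` and `P^∨` thereby yields its dual about `F^∨`, `Q` and `P`. -/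
protected theorem flip (hP : IsEuclidean P) : IsEuclidean P.flip where
  pairing_eq_inner x y := by
    rw [real_inner_comm]
    exact hP.pairing_eq_inner y x
  coroot_eq i := by
    change P.root i = (2 / inner ℝ (P.coroot i) (P.coroot i)) • P.coroot i
    have h := (inner_root_self_pos P i).ne'
    rw [hP.coroot_eq, inner_smul_left, inner_smul_right, smul_smul]
    simp only [conj_trivial]
    field_simp
    simp

end IsEuclidean

/-! ### The highest root -/

section Highest

variable {ι V : Type*} [NormedAddCommGroup V] [InnerProductSpace ℝ V] {P : RootPairing ι ℝ V V}

theorem height_neg (b : P.Base) (i : ι) :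
    b.height (P.reflectionPerm i i) = -b.height i :=
  b.height_reflectionPerm_self i

variable [Finite ι]

theorem height_le_highestRoot [Nonempty ι] (b : P.Base) (i : ι) : b.height i ≤ b.height (highestRoot b) :=
  (Finite.exists_max b.height).choose_spec i

theorem isPos_highestRoot [Nonempty ι] (b : P.Base) : b.IsPos (highestRoot b) := by
  rw [b.isPos_iff']
  have h := height_le_highestRoot b (P.reflectionPerm (highestRoot b) (highestRoot b))
  rw [height_neg] at h
  lia

variable [P.IsCrystallographic]

/-- A positive root that is not a proper summand `β + α` with `α` simple is dominant. -/
theorem inner_root_nonneg_of_add_notMem (hP : IsEuclidean P) (b : P.Base) {i : ι}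
    (hi : b.IsPos i) (hmax : ∀ j ∈ b.support, P.root i + P.root j ∉ Set.range P.root)
    {j : ι} (hj : j ∈ b.support) : 0 ≤ inner ℝ (P.root i) (P.root j) := by
  rw [← hP.pairingIn_nonneg_iff]
  by_contra! h
  -- A negative pairing makes the sum a root unless the two roots are opposite, which positivity of
  -- `i` excludes.
  refine hmax j hj (P.root_add_root_mem_of_pairingIn_neg h fun hij ↦ ?_)
  rw [P.root_eq_neg_iff] at hij
  rw [b.isPos_iff, hij, height_neg, RootPairing.Base.height_one_of_mem_support hj] at hi
  lia

variable [Nonempty ι]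

theorem inner_highestRoot_nonneg (hP : IsEuclidean P) (b : P.Base) {j : ι} (hj : j ∈ b.support) :
    0 ≤ inner ℝ (P.root (highestRoot b)) (P.root j) := by
  refine inner_root_nonneg_of_add_notMem hP b (isPos_highestRoot b) (fun l hl ⟨k, hk⟩ ↦ ?_) hj
  have h := height_le_highestRoot b k
  rw [b.height_add hk, RootPairing.Base.height_one_of_mem_support hl] at h
  lia

variable [P.IsRootSystem] [P.IsIrreducible] [P.IsReduced]

/-- Every coefficient of the highest root is positive. -/
theorem repr_highestRoot_pos (hP : IsEuclidean P) (b : P.Base)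
    (j : b.support) : 0 < b.toWeightBasis.repr (P.root (highestRoot b)) j := by
  set c := b.toWeightBasis.repr (P.root (highestRoot b)) with hc
  have c_nonneg : ∀ l, 0 ≤ c l := (isPos_iff_repr_nonneg b _).1 (isPos_highestRoot b)
  by_contra! hj
  -- Simple roots outside the support `S` of the highest root are orthogonal to those inside, since
  -- the highest root is dominant and distinct simple roots have nonpositive inner products. So the
  -- span of `S` is invariant and nonzero, hence everything by irreducibility, and no simple root
  -- can lie outside.
  let S : Set b.support := {l | c l ≠ 0}
  have inner_nonpos (k l : b.support) (hkl : k ≠ l) :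
      inner ℝ (P.root k) (P.root l) ≤ 0 := by
    by_contra! h
    rw [← hP.pairingIn_pos_iff] at h
    exact h.not_ge (b.pairingIn_le_zero_of_ne (fun h ↦ hkl (Subtype.ext h)) k.2 l.2)
  have orth (k l : b.support) (hk : c k = 0) (hl : c l ≠ 0) :
      inner ℝ (P.root l) (P.root k) = 0 := by
    have h0 := inner_highestRoot_nonneg hP b k.2
    rw [real_inner_comm, inner_eq_sum_repr b] at h0
    have hterm (m : b.support) : c m * inner ℝ (P.root k) (P.root m) ≤ 0 := by
      rcases eq_or_ne k m with rfl | hkm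
      · rw [hk, zero_mul]
      · exact mul_nonpos_of_nonneg_of_nonpos (c_nonneg m) (inner_nonpos k m hkm)
    have h1 := (Finset.sum_eq_zero_iff_of_nonpos fun m _ ↦ hterm m).1
      (le_antisymm (Finset.sum_nonpos fun m _ ↦ hterm m) h0) l (Finset.mem_univ l)
    rw [real_inner_comm]
    exact (mul_eq_zero.1 h1).resolve_left hl
  have htop : Submodule.span ℝ (b.toWeightBasis '' S) = ⊤ := by
    refine RootPairing.IsIrreducible.eq_top_of_invtSubmodule_reflection (P := P) _ ?_ ?_
    · rw [← b.forall_mem_support_invtSubmodule_iff]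
      intro k hk
      rw [Module.End.mem_invtSubmodule, Submodule.span_le]
      rintro _ ⟨l, hl, rfl⟩
      simp only [Submodule.comap_coe, Set.mem_preimage, LinearEquiv.coe_coe, SetLike.mem_coe]
      rw [b.toWeightBasis_apply]
      by_cases hck : c ⟨k, hk⟩ = 0
      · rw [hP.reflection_apply, orth ⟨k, hk⟩ l hck hl, zero_smul, sub_zero]
        exact Submodule.subset_span ⟨l, hl, b.toWeightBasis_apply l⟩
      · rw [P.reflection_apply_root]
        exact Submodule.sub_mem _ (Submodule.subset_span ⟨l, hl, b.toWeightBasis_apply l⟩)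
          (Submodule.smul_mem _ _ (Submodule.subset_span ⟨⟨k, hk⟩, hck, b.toWeightBasis_apply _⟩))
    · intro h
      refine P.ne_zero (highestRoot b) (root_ext b fun l ↦ ?_)
      rw [map_zero, Finsupp.zero_apply]
      by_contra hl
      have : b.toWeightBasis l ∈ Submodule.span ℝ (b.toWeightBasis '' S) :=
        Submodule.subset_span ⟨l, hl, rfl⟩
      rw [h, Submodule.mem_bot] at this
      exact b.toWeightBasis.ne_zero l this
  have hjS : j ∉ S := fun h ↦ h (le_antisymm hj (c_nonneg j))
  exact b.toWeightBasis.linearIndependent.notMem_span_image hjS (htop ▸ Submodule.mem_top)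

/-- The highest root dominates every root coefficientwise. -/
theorem repr_root_le_highestRoot (hP : IsEuclidean P) (b : P.Base)
    (i : ι) (j : b.support) :
    b.toWeightBasis.repr (P.root i) j ≤ b.toWeightBasis.repr (P.root (highestRoot b)) j := by
  -- Take `k` of greatest height among the roots dominating `i`. It is positive and admits no simple
  -- root as summand, so it is dominant and has positive product with the highest root. If `k` is
  -- not the highest root, their difference is then a root of nonpositive height, so its
  -- coefficients are nonpositive.
  let S := {k : ι // ∀ j, b.toWeightBasis.repr (P.root i) j ≤ b.toWeightBasis.repr (P.root k) j}
  have : Nonempty S := ⟨⟨i, fun _ ↦ le_rfl⟩⟩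
  obtain ⟨⟨k, hik⟩, hk⟩ := Finite.exists_max fun k : S ↦ b.height k.1
  have hkpos : b.IsPos k := by
    by_cases hi : b.IsPos i
    · rw [isPos_iff_repr_nonneg] at hi ⊢
      exact fun j ↦ (hi j).trans (hik j)
    · have h1 := hk ⟨P.reflectionPerm i i, fun j ↦ by
        have := repr_root_nonpos b hi j
        rw [P.root_reflectionPerm, P.reflection_apply_self, map_neg, Finsupp.neg_apply]
        linarith⟩
      rw [b.isPos_iff'] at hi ⊢
      rw [height_neg] at h1
      lia
  have hmax : ∀ l ∈ b.support, P.root k + P.root l ∉ Set.range P.root := by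
    rintro l hl ⟨m, hm⟩
    have h1 := hk ⟨m, fun j ↦ by
      have h2 := (isPos_iff_repr_nonneg b l).1 (b.isPos_of_mem_support hl) j
      rw [hm, map_add, Finsupp.add_apply]
      linarith [hik j]⟩
    rw [b.height_add hm, RootPairing.Base.height_one_of_mem_support hl] at h1
    lia
  have hinner : 0 < inner ℝ (P.root k) (P.root (highestRoot b)) := by
    have hnonneg (l : b.support) :
        0 ≤ b.toWeightBasis.repr (P.root (highestRoot b)) l * inner ℝ (P.root k) (P.root l) :=
      mul_nonneg (repr_highestRoot_pos hP b l).le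
        (inner_root_nonneg_of_add_notMem hP b hkpos hmax l.2)
    rw [inner_eq_sum_repr b]
    refine lt_of_le_of_ne (Finset.sum_nonneg fun l _ ↦ hnonneg l) fun h ↦ ?_
    refine P.ne_zero k (eq_zero_of_inner_root_eq_zero b fun l hl ↦ ?_)
    have h1 := (Finset.sum_eq_zero_iff_of_nonneg fun l _ ↦ hnonneg l).1 h.symm ⟨l, hl⟩
      (Finset.mem_univ _)
    exact (mul_eq_zero.1 h1).resolve_left (repr_highestRoot_pos hP b ⟨l, hl⟩).ne'
  refine (hik j).trans ?_
  rw [← hP.pairingIn_pos_iff] at hinner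
  rcases eq_or_ne k (highestRoot b) with rfl | hne
  · exact le_rfl
  obtain ⟨l, hl⟩ := P.root_sub_root_mem_of_pairingIn_pos hinner hne
  have hlneg : ¬ b.IsPos l := by
    rw [b.isPos_iff, b.height_sub hl]
    have := height_le_highestRoot b k
    lia
  have h1 := repr_root_nonpos b hlneg j
  rw [hl, map_sub, Finsupp.sub_apply] at h1
  linarith

theorem neg_highestRoot_le_repr_root (hP : IsEuclidean P)
    (b : P.Base) (i : ι) (j : b.support) :
    -b.toWeightBasis.repr (P.root (highestRoot b)) j ≤ b.toWeightBasis.repr (P.root i) j := by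
  have h := repr_root_le_highestRoot hP b (P.reflectionPerm i i) j
  rw [P.root_reflectionPerm, P.reflection_apply_self, map_neg, Finsupp.neg_apply] at h
  linarith

end Highest

/-! ### Affine roots, affine reflections and the exchange condition -/

section AffineReflections

variable {ι V : Type*} [NormedAddCommGroup V] [InnerProductSpace ℝ V] {P : RootPairing ι ℝ V V}

/-- The value at `x` of the affine root `⟨·, αᵢ⟩ + k` with index `(i, k)`. -/
def affineEval (P : RootPairing ι ℝ V V) (β : ι × ℤ) (x : V) : ℝ :=
  inner ℝ x (P.root β.1) + β.2

/-- The reflection in the zero locus of an affine root, as a function. -/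
def affineReflectionFun (P : RootPairing ι ℝ V V) (β : ι × ℤ) (x : V) : V :=
  x - affineEval P β x • P.coroot β.1

theorem affineEval_affineReflectionFun (hP : IsEuclidean P) [P.IsCrystallographic] (α β : ι × ℤ)
    (x : V) : affineEval P β (affineReflectionFun P α x) =
      affineEval P β x - P.pairingIn ℤ β.1 α.1 * affineEval P α x := by
  simp only [affineReflectionFun, affineEval]
  rw [inner_sub_left, inner_smul_left, real_inner_comm, ← hP.inner_root_coroot,
    real_inner_comm (P.coroot α.1)]
  simp only [conj_trivial]
  rw [real_inner_comm x, real_inner_comm (P.root β.1) (P.coroot α.1)]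
  ring

theorem affineReflectionFun_involutive (hP : IsEuclidean P) (β : ι × ℤ) :
    Function.Involutive (affineReflectionFun P β) := by
  intro x
  have h : affineEval P β (affineReflectionFun P β x) = -affineEval P β x := by
    simp only [affineReflectionFun, affineEval]
    rw [inner_sub_left, inner_smul_left, hP.inner_coroot_root_self]
    simp only [conj_trivial]
    ring
  rw [affineReflectionFun, h, affineReflectionFun]
  simp

/-- The reflection in the zero locus of an affine root. -/
def affineReflection (hP : IsEuclidean P) (β : ι × ℤ) : Equiv.Perm V :=
  (affineReflectionFun_involutive hP β).toPerm

theorem affineReflection_apply (hP : IsEuclidean P) (β : ι × ℤ) (x : V) :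
    affineReflection hP β x = x - affineEval P β x • P.coroot β.1 := rfl

theorem affineReflection_mul_self (hP : IsEuclidean P) (β : ι × ℤ) :
    affineReflection hP β * affineReflection hP β = 1 :=
  Equiv.ext (affineReflectionFun_involutive hP β)

theorem affineReflection_eq_reflection_sub (hP : IsEuclidean P) (β : ι × ℤ) (x : V) :
    affineReflection hP β x = P.reflection β.1 x - β.2 • P.coroot β.1 := by
  rw [affineReflection_apply, hP.reflection_apply, affineEval, add_smul, Int.cast_smul_eq_zsmul]
  abel

theorem affineEval_affineReflection (hP : IsEuclidean P) [P.IsCrystallographic] (α β : ι × ℤ)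
    (x : V) : affineEval P β (affineReflection hP α x) =
      affineEval P β x - P.pairingIn ℤ β.1 α.1 * affineEval P α x :=
  affineEval_affineReflectionFun hP α β x

theorem affineEval_affineReflection_self (hP : IsEuclidean P) [P.IsCrystallographic] (β : ι × ℤ)
    (x : V) : affineEval P β (affineReflection hP β x) = -affineEval P β x := by
  rw [affineEval_affineReflection, P.pairingIn_same]
  push_cast
  ring

theorem affineReflection_eq_self (hP : IsEuclidean P) {β : ι × ℤ} {x : V}
    (h : affineEval P β x = 0) : affineReflection hP β x = x := by
  rw [affineReflection_apply, h, zero_smul, sub_zero]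

/-- The action of the reflection in the affine root `α` on affine roots. -/
noncomputable def reflectAffineRoot (P : RootPairing ι ℝ V V) [P.IsCrystallographic] (α β : ι × ℤ) : ι × ℤ :=
  (P.reflectionPerm α.1 β.1, β.2 - P.pairingIn ℤ β.1 α.1 * α.2)

variable [P.IsCrystallographic]

theorem affineEval_reflectAffineRoot (hP : IsEuclidean P) (α β : ι × ℤ) (x : V) :
    affineEval P (reflectAffineRoot P α β) x = affineEval P β (affineReflection hP α x) := by
  rw [affineEval_affineReflection]
  simp only [affineEval, reflectAffineRoot]
  rw [P.root_reflectionPerm, P.reflection_apply_root' ℤ, inner_sub_right,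
    ← Int.cast_smul_eq_zsmul ℝ, inner_smul_right]
  push_cast
  ring

theorem affineReflection_reflectAffineRoot (hP : IsEuclidean P) (α β : ι × ℤ) :
    affineReflection hP (reflectAffineRoot P α β) =
      affineReflection hP α * affineReflection hP β * affineReflection hP α := by
  ext x
  have key (z : V) (t : ℝ) : affineReflection hP α (z - t • P.coroot β.1) =
      affineReflection hP α z - t • P.reflection α.1 (P.coroot β.1) := by
    rw [affineReflection_eq_reflection_sub, affineReflection_eq_reflection_sub, map_sub, map_smul]
    abel
  rw [Equiv.Perm.mul_apply, Equiv.Perm.mul_apply, affineReflection_apply hP β, key,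
    affineReflection_apply, affineEval_reflectAffineRoot hP]
  have h : affineReflection hP α (affineReflection hP α x) = x :=
    affineReflectionFun_involutive hP α x
  rw [h]
  simp only [reflectAffineRoot]
  rw [P.coroot_reflectionPerm, hP.coreflection_eq]

variable [Finite ι] [Nonempty ι]

/-- The index of the affine root `1 - ⟨·, ξ⟩`. -/
noncomputable def affineSimple (b : P.Base) : ι × ℤ :=
  (P.reflectionPerm (highestRoot b) (highestRoot b), 1)

/-- The simple affine roots: the simple roots and `1 - ⟨·, ξ⟩`. -/
def IsSimpleAffine (b : P.Base) (β : ι × ℤ) : Prop :=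
  (β.1 ∈ b.support ∧ β.2 = 0) ∨ β = affineSimple b

/-- The positive affine roots. -/
def IsPosAffine (b : P.Base) (β : ι × ℤ) : Prop :=
  0 < β.2 ∨ (β.2 = 0 ∧ b.IsPos β.1)

theorem IsSimpleAffine.isPosAffine {b : P.Base} {β : ι × ℤ} (h : IsSimpleAffine b β) :
    IsPosAffine b β := by
  rcases h with h | rfl
  · exact Or.inr ⟨h.2, b.isPos_of_mem_support h.1⟩
  · exact Or.inl one_pos

theorem mem_fundDomain_iff (b : P.Base) (x : V) :
    x ∈ fundDomain b ↔ ∀ β, IsSimpleAffine b β → 0 ≤ affineEval P β x := by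
  constructor
  · rintro ⟨h1, h2⟩ ⟨i, k⟩ (⟨hi, hk⟩ | h)
    · simp only at hi hk
      simpa [affineEval, hk] using h1 i hi
    · rw [h]
      simp [affineEval, affineSimple, inner_neg_right, h2]
  · intro h
    refine ⟨fun i hi ↦ ?_, ?_⟩
    · simpa [affineEval] using h (i, 0) (Or.inl ⟨hi, rfl⟩)
    · simpa [affineEval, affineSimple, inner_neg_right] using h _ (Or.inr rfl)

variable [P.IsRootSystem] [P.IsIrreducible] [P.IsReduced]

theorem inner_root_le_one (hP : IsEuclidean P) {b : P.Base} {x : V} (hx : x ∈ fundDomain b)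
    (i : ι) : inner ℝ x (P.root i) ≤ 1 := by
  have h : 0 ≤ inner ℝ x (P.root (highestRoot b) - P.root i) :=
    inner_nonneg_of_repr_nonneg b hx.1 fun j ↦ by
      rw [map_sub, Finsupp.sub_apply, sub_nonneg]
      exact repr_root_le_highestRoot hP b i j
  rw [inner_sub_right] at h
  linarith [hx.2]

/-- `F` is cut out by the simple affine roots only; maximality of the highest root bounds `⟨x, α⟩`
by 1 for all roots and so brings in all positive affine roots. -/
theorem affineEval_nonneg (hP : IsEuclidean P) {b : P.Base} {x : V} (hx : x ∈ fundDomain b)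
    {β : ι × ℤ} (hβ : IsPosAffine b β) : 0 ≤ affineEval P β x := by
  rcases hβ with h | ⟨h0, h⟩
  · have h1 := inner_root_le_one hP hx (P.reflectionPerm β.1 β.1)
    rw [P.root_reflectionPerm, P.reflection_apply_self, inner_neg_right] at h1
    have h2 : (1 : ℝ) ≤ β.2 := by exact_mod_cast h
    rw [affineEval]
    linarith
  · rw [affineEval, h0]
    simpa using inner_nonneg_of_repr_nonneg b hx.1 ((isPos_iff_repr_nonneg b _).1 h)

theorem pairingIn_highestRoot_nonneg (hP : IsEuclidean P) (b : P.Base) {i : ι} (hi : b.IsPos i) :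
    0 ≤ P.pairingIn ℤ i (highestRoot b) := by
  rw [hP.pairingIn_nonneg_iff, real_inner_comm]
  exact inner_nonneg_of_repr_nonneg b (fun j hj ↦ inner_highestRoot_nonneg hP b hj)
    ((isPos_iff_repr_nonneg b _).1 hi)

theorem reflectAffineRoot_affineSimple (b : P.Base) (β : ι × ℤ) :
    ∃ l, reflectAffineRoot P (affineSimple b) β =
        (l, β.2 + P.pairingIn ℤ β.1 (highestRoot b)) ∧
      P.root l = P.root β.1 - P.pairingIn ℤ β.1 (highestRoot b) • P.root (highestRoot b) := by
  refine ⟨_, Prod.ext rfl ?_, ?_⟩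
  · simp [reflectAffineRoot, affineSimple]
  · simp only [affineSimple, reflectAffineRoot]
    rw [P.root_reflectionPerm, P.reflection_apply_root' ℤ]
    simp

/-- A simple affine reflection permutes the positive affine roots other than its own. -/
theorem IsPosAffine.reflectAffineRoot (hP : IsEuclidean P) {b : P.Base} {α β : ι × ℤ}
    (hα : IsSimpleAffine b α) (hβ : IsPosAffine b β) (hne : β ≠ α) :
    IsPosAffine b (reflectAffineRoot P α β) := by
  rcases hα with ⟨hα, hα0⟩ | rfl
  · have h2 : (EvenGrid.reflectAffineRoot P α β).2 = β.2 := by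
      simp [EvenGrid.reflectAffineRoot, hα0]
    rw [IsPosAffine, h2]
    refine hβ.imp_right fun ⟨h0, h⟩ ↦ ⟨h0, h.reflectionPerm hα fun h ↦ hne ?_⟩
    exact Prod.ext h (h0.trans hα0.symm)
  obtain ⟨l, hl, hroot⟩ := reflectAffineRoot_affineSimple b β
  rw [hl]
  set n := P.pairingIn ℤ β.1 (highestRoot b) with hn
  have hcoef (j : b.support) := congrArg (fun x ↦ b.toWeightBasis.repr x j) hroot
  simp only [map_sub, map_zsmul, Finsupp.sub_apply, Finsupp.smul_apply, zsmul_eq_mul] at hcoef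
  -- Reflecting in `1 - ⟨·, ξ⟩` adds `n` to the constant term, so positivity is in danger only when
  -- `n < 0`.
  rcases le_or_gt 0 n with hn0 | hn0
  · have hk : 0 ≤ β.2 := hβ.elim le_of_lt fun h ↦ h.1.ge
    rcases (add_nonneg hk hn0).lt_or_eq with h | h
    · exact Or.inl h
    · have hk0 : β.2 = 0 := by lia
      have hn00 : n = 0 := by lia
      have hpos : b.IsPos β.1 := hβ.elim (fun h ↦ by lia) And.right
      refine Or.inr ⟨h.symm, ?_⟩
      rw [isPos_iff_repr_nonneg] at hpos ⊢
      intro j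
      simpa [hcoef j, hn00] using hpos j
  have hnpos : ¬ b.IsPos β.1 := fun h ↦ hn0.not_ge (pairingIn_highestRoot_nonneg hP b h)
  have hk : 0 < β.2 := hβ.elim id fun h ↦ absurd h.2 hnpos
  obtain ⟨j₀, hj₀⟩ := b.support_nonempty
  -- The coefficients of `l` are those of `β` minus `n` times those of `ξ`. They are at least `-1 -
  -- n` times and at most once the coefficients of `ξ`, which are positive.
  have hn2 : -2 ≤ n := by
    have h1 := hcoef ⟨j₀, hj₀⟩
    have h2 := repr_root_le_highestRoot hP b l ⟨j₀, hj₀⟩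
    have h3 := neg_highestRoot_le_repr_root hP b β.1 ⟨j₀, hj₀⟩
    have h4 := repr_highestRoot_pos hP b ⟨j₀, hj₀⟩
    by_contra! h
    have h5 : (n : ℝ) ≤ -3 := by exact_mod_cast (by lia : n ≤ -3)
    nlinarith
  have hlpos : b.IsPos l := by
    rw [isPos_iff_repr_nonneg]
    intro j
    have h3 := neg_highestRoot_le_repr_root hP b β.1 j
    have h4 := repr_highestRoot_pos hP b j
    have h5 : (n : ℝ) ≤ -1 := by exact_mod_cast (by lia : n ≤ -1)
    rw [hcoef j]
    nlinarith
  rcases (by lia : 0 < β.2 + n ∨ β.2 + n = 0 ∨ (β.2 = 1 ∧ n = -2)) with h | h | ⟨h1, h2⟩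
  · exact Or.inl h
  · exact Or.inr ⟨h, hlpos⟩
  -- With `n = -2` the bounds are attained, so `β.1` is `-ξ` and `β` is the reflecting root itself.
  · refine absurd (Prod.ext ?_ h1) hne
    rw [affineSimple, ← P.root_eq_neg_iff]
    refine root_ext b fun j ↦ ?_
    have h4 := hcoef j
    have h5 := repr_root_le_highestRoot hP b l j
    have h6 := neg_highestRoot_le_repr_root hP b β.1 j
    rw [h2] at h4
    push_cast at h4
    rw [map_neg, Finsupp.neg_apply]
    linarith

/-- When the constant term is positive: the gradients `αⱼ` and `-ξ` of the simple affine roots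
satisfy a linear relation with all coefficients positive. A root pairing nonpositively with all of
them would be orthogonal to every simple root. -/
theorem IsPosAffine.exists_simple_pairingIn_pos (hP : IsEuclidean P) {b : P.Base} {β : ι × ℤ}
    (hβ : IsPosAffine b β) : ∃ α, IsSimpleAffine b α ∧ 0 < P.pairingIn ℤ β.1 α.1 := by
  rcases hβ with h | ⟨-, h⟩
  · by_contra! hcon
    have h1 (j : b.support) : inner ℝ (P.root β.1) (P.root j) ≤ 0 := by
      have := hcon (j, 0) (Or.inl ⟨j.2, rfl⟩)
      by_contra! hj
      rw [← hP.pairingIn_pos_iff] at hj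
      exact hj.not_ge this
    have h2 : 0 ≤ inner ℝ (P.root β.1) (P.root (highestRoot b)) := by
      have := hcon _ (Or.inr rfl)
      rw [← hP.pairingIn_nonneg_iff]
      simpa [affineSimple] using this
    have hterm (j : b.support) : b.toWeightBasis.repr (P.root (highestRoot b)) j *
        inner ℝ (P.root β.1) (P.root j) ≤ 0 :=
      mul_nonpos_of_nonneg_of_nonpos (repr_highestRoot_pos hP b j).le (h1 j)
    rw [inner_eq_sum_repr b] at h2
    have h3 := (Finset.sum_eq_zero_iff_of_nonpos fun j _ ↦ hterm j).1
      (le_antisymm (Finset.sum_nonpos fun j _ ↦ hterm j) h2)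
    refine P.ne_zero β.1 (eq_zero_of_inner_root_eq_zero b fun j hj ↦ ?_)
    exact (mul_eq_zero.1 (h3 ⟨j, hj⟩ (Finset.mem_univ _))).resolve_left
      (repr_highestRoot_pos hP b ⟨j, hj⟩).ne'
  · obtain ⟨j, hj, hpos⟩ := h.exists_mem_support_pos_pairingIn
    exact ⟨(j, 0), Or.inl ⟨hj, rfl⟩, (P.zero_lt_pairingIn_iff' ℤ).1 hpos⟩

/-- The group generated by the simple affine reflections. -/
def simpleAffineGroup (hP : IsEuclidean P) (b : P.Base) : Subgroup (Equiv.Perm V) :=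
  Subgroup.closure (affineReflection hP '' {β | IsSimpleAffine b β})

/-- The height of an affine root: the sum of its coefficients in the simple affine roots. -/
noncomputable def affineHeight (b : P.Base) (β : ι × ℤ) : ℤ :=
  b.height β.1 + β.2 * (b.height (highestRoot b) + 1)

/-- The constant 1 is `(1 - ξ) + ξ` and so has height `b.height ξ + 1`, which exceeds the drop any
root can cause. -/
theorem affineHeight_pos {b : P.Base} {β : ι × ℤ} (hβ : IsPosAffine b β) :
    0 < affineHeight b β := by
  rcases hβ with h | ⟨h0, h⟩
  · have h1 := height_le_highestRoot b (P.reflectionPerm β.1 β.1)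
    have h2 := (b.isPos_iff).1 (isPos_highestRoot b)
    rw [height_neg] at h1
    rw [affineHeight]
    nlinarith
  · rw [b.isPos_iff] at h
    simpa [affineHeight, h0] using h

theorem affineHeight_simple {b : P.Base} {α : ι × ℤ} (hα : IsSimpleAffine b α) :
    affineHeight b α = 1 := by
  rcases hα with ⟨h, h0⟩ | rfl
  · simp [affineHeight, h0, RootPairing.Base.height_one_of_mem_support h]
  · simp [affineHeight, affineSimple, height_neg]

theorem affineHeight_reflectAffineRoot (b : P.Base) (α β : ι × ℤ) :
    affineHeight b (reflectAffineRoot P α β) =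
      affineHeight b β - P.pairingIn ℤ β.1 α.1 * affineHeight b α := by
  have h : P.root (P.reflectionPerm α.1 β.1) =
      P.root β.1 + (-P.pairingIn ℤ β.1 α.1) • P.root α.1 := by
    rw [P.root_reflectionPerm, P.reflection_apply_root' ℤ, neg_smul, sub_eq_add_neg]
  simp only [affineHeight, reflectAffineRoot]
  rw [b.height_add_zsmul h, smul_eq_mul]
  ring

theorem affineReflection_mem_of_isSimpleAffine (hP : IsEuclidean P) {b : P.Base} {α : ι × ℤ}
    (hα : IsSimpleAffine b α) : affineReflection hP α ∈ simpleAffineGroup hP b :=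
  Subgroup.subset_closure ⟨α, hα, rfl⟩

/-- Induction on the affine height: conjugating by a simple reflection whose root pairs positively
with `β` lowers the height and, unless `β` is that root, keeps it positive. -/
theorem affineReflection_mem (hP : IsEuclidean P) {b : P.Base} {β : ι × ℤ}
    (hβ : IsPosAffine b β) : affineReflection hP β ∈ simpleAffineGroup hP b := by
  obtain ⟨n, hn⟩ : ∃ n : ℕ, affineHeight b β = n :=
    ⟨_, (Int.toNat_of_nonneg (affineHeight_pos hβ).le).symm⟩
  induction n using Nat.strong_induction_on generalizing β with
  | _ n ih =>
    obtain ⟨α, hα, hpos⟩ := hβ.exists_simple_pairingIn_pos hP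
    have hαmem := affineReflection_mem_of_isSimpleAffine hP hα
    rcases eq_or_ne β α with rfl | hne
    · exact hαmem
    have hγ := hβ.reflectAffineRoot hP hα hne
    have hheight := affineHeight_reflectAffineRoot b α β
    rw [affineHeight_simple hα, hn, mul_one] at hheight
    have h0 := affineHeight_pos hγ
    have hmem := ih (affineHeight b (reflectAffineRoot P α β)).toNat (by lia) hγ (by lia)
    rw [affineReflection_reflectAffineRoot] at hmem
    have := mul_mem (mul_mem hαmem hmem) hαmem
    simpa only [mul_assoc, affineReflection_mul_self, mul_one, ← mul_assoc (affineReflection hP α)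
      (affineReflection hP α), one_mul] using this

/-- The product of the reflections in a list of affine roots. -/
def affineWord (hP : IsEuclidean P) (l : List (ι × ℤ)) : Equiv.Perm V :=
  (l.map (affineReflection hP)).prod

/-- The action of a product of reflections on affine roots. -/
noncomputable def affineWordAct (P : RootPairing ι ℝ V V) [P.IsCrystallographic] (l : List (ι × ℤ))
    (β : ι × ℤ) : ι × ℤ :=
  l.foldr (reflectAffineRoot P) β

theorem affineEval_affineWordAct (hP : IsEuclidean P) (l : List (ι × ℤ)) (β : ι × ℤ) (x : V) :
    affineEval P (affineWordAct P l β) (affineWord hP l x) = affineEval P β x := by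
  induction l with
  | nil => rfl
  | cons α l ih =>
    rw [← ih, affineWord, List.map_cons, List.prod_cons, Equiv.Perm.mul_apply]
    refine (affineEval_reflectAffineRoot hP α (affineWordAct P l β) _).trans ?_
    exact congrArg _ (affineReflectionFun_involutive hP α _)

theorem affineReflection_affineWordAct (hP : IsEuclidean P) (l : List (ι × ℤ)) (β : ι × ℤ) :
    affineReflection hP (affineWordAct P l β) * affineWord hP l =
      affineWord hP l * affineReflection hP β := by
  induction l with
  | nil => simp [affineWord, affineWordAct]
  | cons α l ih =>
    have h1 : affineWord hP (α :: l) = affineReflection hP α * affineWord hP l := by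
      simp [affineWord]
    have h2 : affineWordAct P (α :: l) β = reflectAffineRoot P α (affineWordAct P l β) := rfl
    rw [h1, h2, affineReflection_reflectAffineRoot, mul_assoc _ (affineReflection hP α),
      ← mul_assoc (affineReflection hP α) (affineReflection hP α), affineReflection_mul_self,
      one_mul, mul_assoc, ih, mul_assoc]

/-- The exchange condition. -/
theorem exists_affineWord_eq_mul (hP : IsEuclidean P) {b : P.Base} {l : List (ι × ℤ)}
    (hl : ∀ α ∈ l, IsSimpleAffine b α) {β : ι × ℤ} (hβ : IsSimpleAffine b β)
    (hneg : ¬ IsPosAffine b (affineWordAct P l β)) :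
    ∃ l' : List (ι × ℤ), (∀ α ∈ l', IsSimpleAffine b α) ∧ l'.length + 1 = l.length ∧
      affineWord hP l * affineReflection hP β = affineWord hP l' := by
  induction l with
  | nil => exact absurd hβ.isPosAffine hneg
  | cons α l ih =>
    have hα := hl α List.mem_cons_self
    have hl' : ∀ γ ∈ l, IsSimpleAffine b γ := fun γ hγ ↦ hl γ (List.mem_cons_of_mem _ hγ)
    have hword (l : List (ι × ℤ)) :
        affineWord hP (α :: l) = affineReflection hP α * affineWord hP l := by simp [affineWord]
    by_cases hpos : IsPosAffine b (affineWordAct P l β)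
    · refine ⟨l, hl', rfl, ?_⟩
      -- The root turns negative exactly at `α`, and only `α` itself is made negative by its
      -- reflection. Thus conjugating `β` by the tail gives `α`, and the two reflections cancel.
      have heq : affineWordAct P l β = α := by
        by_contra hne
        exact hneg (hpos.reflectAffineRoot hP hα hne)
      rw [hword, mul_assoc, ← affineReflection_affineWordAct, heq, ← mul_assoc,
        affineReflection_mul_self, one_mul]
    · obtain ⟨l', h1, h2, h3⟩ := ih hl' hpos
      refine ⟨α :: l', ?_, by simp [h2], by rw [hword, hword, mul_assoc, h3]⟩
      intro γ hγ
      rcases List.mem_cons.1 hγ with rfl | hγ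
      · exact hα
      · exact h1 γ hγ

/-- The region `F` meets every orbit of the affine group at most once, and the stabilizers of its
interior points are trivial. -/
theorem affineWord_apply_eq_self (hP : IsEuclidean P) {b : P.Base} {x : V} (hx : x ∈ fundDomain b)
    {l : List (ι × ℤ)} (hl : ∀ α ∈ l, IsSimpleAffine b α)
    (hlx : affineWord hP l x ∈ fundDomain b) :
    affineWord hP l x = x ∧
      ((∀ α, IsSimpleAffine b α → 0 < affineEval P α x) → affineWord hP l = 1) := by
  obtain ⟨n, hn⟩ : ∃ n, l.length = n := ⟨_, rfl⟩
  induction n using Nat.strong_induction_on generalizing l with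
  | _ n ih =>
    rcases List.eq_nil_or_concat' l with rfl | ⟨l, β, rfl⟩
    · simp [affineWord]
    have hβ : IsSimpleAffine b β := hl β (by simp)
    have hl' : ∀ α ∈ l, IsSimpleAffine b α := fun α hα ↦ hl α (by simp [hα])
    have hword : affineWord hP (l ++ [β]) = affineWord hP l * affineReflection hP β := by
      simp [affineWord]
    rw [List.length_append, List.length_singleton] at hn
    rw [hword] at hlx ⊢
    by_cases hpos : IsPosAffine b (affineWordAct P l β)
    -- Evaluating the transported root at the image point gives `-β(x)`, which must be nonnegative.
    -- So `x` lies on the wall of `β`, and the last letter fixes `x` and can be dropped; for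
    -- interior `x` this is impossible. In the other case exchange shortens the word without
    -- changing its value.
    · have h1 := affineEval_nonneg hP hlx hpos
      rw [Equiv.Perm.mul_apply, affineEval_affineWordAct, affineEval_affineReflection_self] at h1
      have h2 : affineEval P β x = 0 :=
        le_antisymm (by linarith) (affineEval_nonneg hP hx hβ.isPosAffine)
      rw [Equiv.Perm.mul_apply, affineReflection_eq_self hP h2] at hlx ⊢
      exact ⟨(ih l.length (by lia) hl' hlx rfl).1, fun h ↦ absurd h2 (h β hβ).ne'⟩
    · obtain ⟨l', h1, h2, h3⟩ := exists_affineWord_eq_mul hP hl' hβ hpos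
      rw [h3] at hlx ⊢
      exact ih l'.length (by lia) h1 hlx rfl

theorem exists_affineWord_eq (hP : IsEuclidean P) {b : P.Base} {g : Equiv.Perm V}
    (hg : g ∈ simpleAffineGroup hP b) :
    ∃ l : List (ι × ℤ), (∀ α ∈ l, IsSimpleAffine b α) ∧ affineWord hP l = g := by
  induction hg using Subgroup.closure_induction'' with
  | mem x hx =>
    obtain ⟨α, hα, rfl⟩ := hx
    exact ⟨[α], by simpa using hα, by simp [affineWord]⟩
  | inv_mem x hx =>
    obtain ⟨α, hα, rfl⟩ := hx
    exact ⟨[α], by simpa using hα, by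
      simp [affineWord, eq_inv_iff_mul_eq_one, affineReflection_mul_self]⟩
  | one => exact ⟨[], by simp, by simp [affineWord]⟩
  | mul x y _ _ hx hy =>
    obtain ⟨l, hl, rfl⟩ := hx
    obtain ⟨l', hl', rfl⟩ := hy
    exact ⟨l ++ l', by simpa [or_imp, forall_and] using ⟨fun i k h ↦ hl _ h, fun i k h ↦ hl' _ h⟩,
      by simp [affineWord]⟩

end AffineReflections

/-! ### The four lattices and their duality -/

section Lattices

variable {ι V : Type*} [NormedAddCommGroup V] [InnerProductSpace ℝ V] {P : RootPairing ι ℝ V V}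

/-- Generation by all coroots makes invariance under the Weyl group visible;
`mem_dualWeightLattice_iff` does the same for the dual weight lattice. -/
theorem dualRootLattice_eq_closure_range (b : P.Base) :
    dualRootLattice b = AddSubgroup.closure (Set.range P.coroot) := by
  have h := b.span_int_coroot_support
  have := congrArg Submodule.toAddSubgroup h
  rwa [Submodule.span_int_eq_addSubgroupClosure, Submodule.span_int_eq_addSubgroupClosure] at this

theorem coroot_mem_dualRootLattice (b : P.Base) (i : ι) : P.coroot i ∈ dualRootLattice b := by
  rw [dualRootLattice_eq_closure_range]
  exact AddSubgroup.subset_closure ⟨i, rfl⟩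

theorem mem_dualWeightLattice_iff (b : P.Base) {x : V} :
    x ∈ dualWeightLattice b ↔ ∀ i, ∃ k : ℤ, inner ℝ x (P.root i) = k := by
  refine ⟨fun h i ↦ ?_, fun h i _ ↦ h i⟩
  refine Submodule.span_induction (p := fun y _ ↦ ∃ k : ℤ, inner ℝ x y = k) ?_ ⟨0, by simp⟩ ?_ ?_
    (b.root_mem_span_int i)
  · rintro _ ⟨j, hj, rfl⟩
    exact h j hj
  · rintro y z - - ⟨k, hk⟩ ⟨l, hl⟩
    exact ⟨k + l, by rw [inner_add_right, hk, hl]; push_cast; rfl⟩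
  · rintro n y - ⟨k, hk⟩
    exact ⟨n * k, by rw [← Int.cast_smul_eq_zsmul ℝ, inner_smul_right, hk]; push_cast; rfl⟩

theorem exists_inner_eq_int {L : AddSubgroup V} {s : Set V}
    (h : ∀ x ∈ L, ∀ y ∈ s, ∃ k : ℤ, inner ℝ x y = k) {x y : V} (hx : x ∈ L)
    (hy : y ∈ AddSubgroup.closure s) : ∃ k : ℤ, inner ℝ x y = k := by
  induction hy using AddSubgroup.closure_induction with
  | mem y hy => exact h x hx y hy
  | zero => exact ⟨0, by simp⟩
  | add y z _ _ hy hz =>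
    obtain ⟨k, hk⟩ := hy
    obtain ⟨l, hl⟩ := hz
    exact ⟨k + l, by rw [inner_add_right, hk, hl]; push_cast; rfl⟩
  | neg y _ hy =>
    obtain ⟨k, hk⟩ := hy
    exact ⟨-k, by rw [inner_neg_right, hk]; push_cast; rfl⟩

theorem inner_weight_dualRoot (b : P.Base) {x y : V} (hx : x ∈ weightLattice b)
    (hy : y ∈ dualRootLattice b) : ∃ k : ℤ, inner ℝ x y = k :=
  exists_inner_eq_int (L := weightLattice b) (by rintro x hx _ ⟨i, hi, rfl⟩; exact hx i hi) hx hy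

theorem inner_dualWeight_root (b : P.Base) {x y : V} (hx : x ∈ dualWeightLattice b)
    (hy : y ∈ rootLattice b) : ∃ k : ℤ, inner ℝ x y = k :=
  inner_weight_dualRoot b.flip hx hy

theorem dualRootLattice_le (hP : IsEuclidean P) [P.IsCrystallographic] (b : P.Base) :
    dualRootLattice b ≤ dualWeightLattice b := by
  refine (AddSubgroup.closure_le _).2 ?_
  rintro _ ⟨i, -, rfl⟩ j -
  exact ⟨_, by rw [real_inner_comm, hP.inner_root_coroot]⟩

theorem exists_inner_root_eq [P.IsRootSystem] (hP : IsEuclidean P) (b : P.Base)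
    (f : b.support → ℝ) : ∃ x : V, ∀ j : b.support, inner ℝ x (P.root j) = f j := by
  have hbij := (P.flip.isPerfPair_toLinearMap).bijective_left
  obtain ⟨x, hx⟩ := hbij.2 (b.toWeightBasis.constr ℝ f)
  refine ⟨x, fun j ↦ ?_⟩
  rw [← hP.flip.pairing_eq_inner, hx, ← b.toWeightBasis_apply, Module.Basis.constr_basis]

/-- The root lattice is the dual of the dual weight lattice. -/
theorem mem_rootLattice_of_forall_inner [P.IsRootSystem] (hP : IsEuclidean P) (b : P.Base) {x : V}
    (h : ∀ y ∈ dualWeightLattice b, ∃ k : ℤ, inner ℝ y x = k) : x ∈ rootLattice b := by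
  classical
  rw [← b.toWeightBasis.sum_repr x]
  refine sum_mem fun j _ ↦ ?_
  -- `y` is the fundamental coweight of `j`; pairing with it reads off the `j`-th coefficient of
  -- `x`.
  obtain ⟨y, hy⟩ := exists_inner_root_eq hP b (Pi.single j 1)
  obtain ⟨k, hk⟩ := h y fun i hi ↦ by
    rw [hy ⟨i, hi⟩, Pi.single_apply]
    split_ifs
    exacts [⟨1, by simp⟩, ⟨0, by simp⟩]
  have : b.toWeightBasis.repr x j = k := by
    rw [← hk, inner_eq_sum_repr b]
    simp [hy, Pi.single_apply]
  rw [this, b.toWeightBasis_apply, Int.cast_smul_eq_zsmul]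
  exact zsmul_mem (AddSubgroup.subset_closure (Set.mem_image_of_mem _ j.2)) k

/-- A set of vectors with bounded coordinates in a lattice is finite. -/
theorem finite_of_inner_root_mem [P.IsRootSystem] (b : P.Base) {c R : ℝ}
    (hc : 0 < c) {S : Set V} (hint : ∀ x ∈ S, ∀ j ∈ b.support, ∃ k : ℤ, c * inner ℝ x (P.root j) = k)
    (hbdd : ∀ x ∈ S, ∀ j ∈ b.support, |inner ℝ x (P.root j)| ≤ R) : S.Finite := by
  let f (x : V) (j : b.support) : ℝ := c * inner ℝ x (P.root j)
  refine Set.Finite.of_finite_image (f := f) ?_ ?_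
  · refine (Set.Finite.pi' fun _ : b.support ↦
      (Set.finite_Icc (-⌈c * R⌉) ⌈c * R⌉).image ((↑) : ℤ → ℝ)).subset ?_
    rintro _ ⟨x, hx, rfl⟩ j
    obtain ⟨k, hk⟩ := hint x hx j j.2
    refine ⟨k, ?_, hk.symm⟩
    have h1 : |(k : ℝ)| ≤ c * R := by
      rw [← hk, abs_mul, abs_of_pos hc]
      exact mul_le_mul_of_nonneg_left (hbdd x hx j j.2) hc.le
    have h2 : |k| ≤ ⌈c * R⌉ := by
      have := h1.trans (Int.le_ceil _)
      exact_mod_cast this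
    exact abs_le.1 h2
  · intro x _ y _ hxy
    rw [← sub_eq_zero]
    refine eq_zero_of_inner_root_eq_zero b fun j hj ↦ ?_
    have := congrFun hxy ⟨j, hj⟩
    rw [inner_sub_left, sub_eq_zero]
    exact mul_left_cancel₀ hc.ne' this

end Lattices

/-! ### The Weyl group and its even subgroup -/

section Reflections

variable {ι V : Type*} [NormedAddCommGroup V] [InnerProductSpace ℝ V] {P : RootPairing ι ℝ V V}

/-- The Weyl group, acting on `V`. -/
def reflectionGroup (P : RootPairing ι ℝ V V) : Subgroup (V ≃ₗ[ℝ] V) :=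
  Subgroup.closure (Set.range P.reflection)

/-- The elements of determinant one of the Weyl group. -/
noncomputable def evenGroup (P : RootPairing ι ℝ V V) : Subgroup (V ≃ₗ[ℝ] V) :=
  reflectionGroup P ⊓ LinearEquiv.det.ker

theorem reflection_mem_reflectionGroup (P : RootPairing ι ℝ V V) (i : ι) :
    P.reflection i ∈ reflectionGroup P :=
  Subgroup.subset_closure ⟨i, rfl⟩

theorem reflectionGroup_flip (hP : IsEuclidean P) : reflectionGroup P.flip = reflectionGroup P := by
  have h : (P.flip.reflection : ι → V ≃ₗ[ℝ] V) = P.reflection := funext hP.coreflection_eq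
  rw [reflectionGroup, h, reflectionGroup]

theorem evenGroup_flip (hP : IsEuclidean P) : evenGroup P.flip = evenGroup P := by
  rw [evenGroup, reflectionGroup_flip hP, evenGroup]

theorem reflectionGroup_induction {p : (V ≃ₗ[ℝ] V) → Prop} (one : p 1)
    (mul : ∀ i w, p w → p (P.reflection i * w)) {w : V ≃ₗ[ℝ] V} (hw : w ∈ reflectionGroup P) :
    p w := by
  induction hw using Subgroup.closure_induction_left with
  | one => exact one
  | mul_left x hx y _ hy =>
    obtain ⟨i, rfl⟩ := hx
    exact mul i y hy
  -- A reflection is definitionally its own inverse, so the previous argument applies verbatim.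
  | inv_mul_cancel x hx y _ hy =>
    obtain ⟨i, rfl⟩ := hx
    exact mul i y hy

theorem inner_map_map (hP : IsEuclidean P) {w : V ≃ₗ[ℝ] V} (hw : w ∈ reflectionGroup P) (x y : V) :
    inner ℝ (w x) (w y) = inner ℝ x y :=
  reflectionGroup_induction (p := fun w ↦ inner ℝ (w x) (w y) = inner ℝ x y) rfl
    (fun i _ h ↦ (hP.inner_reflection_reflection i _ _).trans h) hw

theorem norm_map (hP : IsEuclidean P) {w : V ≃ₗ[ℝ] V} (hw : w ∈ reflectionGroup P) (x : V) :
    ‖w x‖ = ‖x‖ := by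
  rw [@norm_eq_sqrt_real_inner V, @norm_eq_sqrt_real_inner V, inner_map_map hP hw]

theorem exists_map_root_eq {w : V ≃ₗ[ℝ] V} (hw : w ∈ reflectionGroup P) (i : ι) :
    ∃ k, w (P.root i) = P.root k :=
  reflectionGroup_induction (p := fun w ↦ ∃ k, w (P.root i) = P.root k) ⟨i, rfl⟩
    (fun j _ ⟨k, hk⟩ ↦ ⟨P.reflectionPerm j k, by
      rw [LinearEquiv.mul_apply, hk, P.root_reflectionPerm]⟩) hw

/-- An element permutes the finitely many roots and is determined by its values on the simple ones.
-/
theorem finite_reflectionGroup [Finite ι] [P.IsRootSystem] (b : P.Base) :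
    Finite (reflectionGroup P) := by
  refine Finite.of_injective
    (fun (w : reflectionGroup P) (i : ι) ↦
      (⟨w.1 (P.root i), (exists_map_root_eq w.2 i).imp fun _ h ↦ h.symm⟩ : Set.range P.root)) ?_
  intro v w h
  refine Subtype.ext (LinearEquiv.toLinearMap_injective (b.toWeightBasis.ext fun j ↦ ?_))
  rw [b.toWeightBasis_apply]
  exact congrArg Subtype.val (congrFun h j)

theorem map_mem_dualWeightLattice (hP : IsEuclidean P) (b : P.Base) {w : V ≃ₗ[ℝ] V}
    (hw : w ∈ reflectionGroup P) {x : V} (hx : x ∈ dualWeightLattice b) :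
    w x ∈ dualWeightLattice b := by
  rw [mem_dualWeightLattice_iff] at hx ⊢
  intro i
  obtain ⟨k, hk⟩ := exists_map_root_eq (inv_mem hw) i
  rw [← inner_map_map hP (inv_mem hw), hk]
  have : w⁻¹ (w x) = x := w.symm_apply_apply x
  rw [this]
  exact hx k

theorem map_mem_dualRootLattice (hP : IsEuclidean P) (b : P.Base) {w : V ≃ₗ[ℝ] V}
    (hw : w ∈ reflectionGroup P) {x : V} (hx : x ∈ dualRootLattice b) :
    w x ∈ dualRootLattice b := by
  rw [dualRootLattice_eq_closure_range] at hx ⊢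
  induction hx using AddSubgroup.closure_induction with
  | mem x hx =>
    obtain ⟨i, rfl⟩ := hx
    rw [← reflectionGroup_flip hP] at hw
    obtain ⟨k, hk⟩ := exists_map_root_eq (P := P.flip) hw i
    exact AddSubgroup.subset_closure ⟨k, hk.symm⟩
  | zero => rw [map_zero]; exact zero_mem _
  | add x y _ _ hx hy => rw [map_add]; exact add_mem hx hy
  | neg x _ hx => rw [map_neg]; exact neg_mem hx

theorem det_reflection [Finite ι] [P.IsRootSystem] (hP : IsEuclidean P) (b : P.Base) (i : ι) :
    LinearEquiv.det (P.reflection i) = -1 := by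
  have : FiniteDimensional ℝ V := Module.Basis.finiteDimensional_of_finite b.toWeightBasis
  have heq : P.reflection i = (ℝ ∙ P.root i)ᗮ.reflection.toLinearEquiv := by
    ext x
    rw [hP.reflection_apply, hP.coroot_eq, smul_smul]
    simp only [LinearIsometryEquiv.coe_toLinearEquiv]
    rw [Submodule.reflection_orthogonal_apply, Submodule.reflection_singleton_apply]
    simp only [RCLike.ofReal_real_eq_id, id_eq, neg_sub]
    rw [← real_inner_self_eq_norm_sq, real_inner_comm, ← Nat.cast_smul_eq_nsmul ℝ, smul_smul]
    congr 2
    push_cast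
    ring
  ext
  rw [LinearEquiv.coe_det, heq]
  refine (Submodule.det_reflection _).trans ?_
  rw [Submodule.orthogonal_orthogonal, finrank_span_singleton (P.ne_zero i)]
  simp

theorem det_eq_one_or [Finite ι] [P.IsRootSystem] (hP : IsEuclidean P) (b : P.Base)
    {w : V ≃ₗ[ℝ] V} (hw : w ∈ reflectionGroup P) :
    LinearEquiv.det w = 1 ∨ LinearEquiv.det w = -1 := by
  refine reflectionGroup_induction (P := P)
    (p := fun w ↦ LinearEquiv.det w = 1 ∨ LinearEquiv.det w = -1) (Or.inl (map_one _)) ?_ hw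
  intro i w h
  rw [map_mul, det_reflection hP b]
  rcases h with h | h <;> simp [h]

theorem reflection_mul_mem_evenGroup [Finite ι] [P.IsRootSystem] (hP : IsEuclidean P) (b : P.Base)
    {w : V ≃ₗ[ℝ] V} (hw : w ∈ reflectionGroup P) (hdet : LinearEquiv.det w ≠ 1) (i : ι) :
    P.reflection i * w ∈ evenGroup P := by
  refine ⟨mul_mem (reflection_mem_reflectionGroup P i) hw, ?_⟩
  change LinearEquiv.det _ = 1
  rw [map_mul, det_reflection hP b,
    (det_eq_one_or hP b hw).resolve_left hdet, neg_mul_neg, one_mul]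

end Reflections

/-! ### Fundamental domains of the affine and even affine Weyl groups -/

section FundamentalDomain

variable {ι V : Type*} [Finite ι] [Nonempty ι] [NormedAddCommGroup V] [InnerProductSpace ℝ V]
  {P : RootPairing ι ℝ V V} [P.IsRootSystem] [P.IsCrystallographic]

/-- The point is `v / (b.height ξ + 1)` with `⟨v, αⱼ⟩ = 1` for all simple roots; every simple affine
root takes the value `1 / (b.height ξ + 1)` there. -/
theorem exists_affineEval_pos (hP : IsEuclidean P) (b : P.Base) :
    ∃ p : V, ∀ α, IsSimpleAffine b α → 0 < affineEval P α p := by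
  obtain ⟨v, hv⟩ := exists_inner_root_eq hP b fun _ ↦ 1
  have hξ : inner ℝ v (P.root (highestRoot b)) = b.height (highestRoot b) := by
    rw [inner_eq_sum_repr b, height_eq_sum_repr]
    simp [hv]
  have hpos : (0 : ℝ) < b.height (highestRoot b) := by exact_mod_cast isPos_highestRoot b
  refine ⟨((b.height (highestRoot b) : ℝ) + 1)⁻¹ • v, ?_⟩
  rintro ⟨i, k⟩ (⟨hi, hk⟩ | h)
  · simp only at hi hk
    rw [affineEval, hk, inner_smul_left, hv ⟨i, hi⟩]
    simp only [conj_trivial, Int.cast_zero]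
    positivity
  · rw [h, affineEval, affineSimple, P.root_reflectionPerm, P.reflection_apply_self,
      inner_neg_right, inner_smul_left, hξ]
    simp only [conj_trivial, Int.cast_one]
    have : ((b.height (highestRoot b) : ℝ) + 1)⁻¹ * b.height (highestRoot b) < 1 := by
      rw [inv_mul_lt_iff₀ (by positivity)]
      linarith
    linarith

/-- Reflecting `y` brings it closer to `p` exactly when the hyperplane separates the two. -/
theorem norm_affineReflection_sub_sq (hP : IsEuclidean P) (α : ι × ℤ) (y p : V) :
    ‖affineReflection hP α y - p‖ ^ 2 = ‖y - p‖ ^ 2 +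
      4 / inner ℝ (P.root α.1) (P.root α.1) * (affineEval P α y * affineEval P α p) := by
  have h := (IsEuclidean.inner_root_self_pos P α.1).ne'
  rw [affineReflection_apply, sub_right_comm, @norm_sub_sq_real V, inner_smul_right,
    hP.inner_coroot, norm_smul, mul_pow, ← real_inner_self_eq_norm_sq (P.coroot α.1),
    hP.inner_coroot, hP.inner_coroot_root_self, inner_sub_left, Real.norm_eq_abs, sq_abs]
  simp only [affineEval]
  field_simp
  ring

/-- Every orbit of the affine Weyl group meets `F`. -/
theorem exists_map_add_mem_fundDomain (hP : IsEuclidean P) (b : P.Base) (x : V) :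
    ∃ w ∈ reflectionGroup P, ∃ q ∈ dualRootLattice b, w x + q ∈ fundDomain b := by
  have := finite_reflectionGroup b
  obtain ⟨p, hp⟩ := exists_affineEval_pos hP b
  -- A translation longer than `R` leaves every `v x` farther from `p` than `x` itself, so a minimum
  -- over the finite set `T` is a minimum over the whole orbit.
  let R := ‖x - p‖ + ‖x‖ + ‖p‖
  let B : Set V := {q | q ∈ dualRootLattice b ∧ ‖q‖ ≤ R}
  have hB : B.Finite := by
    have hfin : (Set.range fun j : b.support ↦ ‖P.root j‖).Finite := Set.finite_range _
    obtain ⟨C, hC⟩ := hfin.bddAbove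
    refine finite_of_inner_root_mem b (c := 1) (R := R * C) one_pos (fun q hq j hj ↦ ?_)
      fun q hq j hj ↦ ?_
    · rw [one_mul]
      exact dualRootLattice_le hP b hq.1 j hj
    · refine (abs_real_inner_le_norm _ _).trans
        (mul_le_mul hq.2 (hC ⟨⟨j, hj⟩, rfl⟩) (norm_nonneg _) ?_)
      positivity
  let T : Set ((V ≃ₗ[ℝ] V) × V) := (reflectionGroup P : Set (V ≃ₗ[ℝ] V)) ×ˢ B
  have hT : T.Finite := Set.Finite.prod (Set.toFinite _) hB
  have h1T : (1, 0) ∈ T :=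
    ⟨one_mem (reflectionGroup P), zero_mem (dualRootLattice b), by rw [norm_zero]; positivity⟩
  obtain ⟨⟨w, q⟩, ⟨hw, hq, -⟩, hmin⟩ :=
    Set.exists_min_image T (fun t ↦ ‖t.1 x + t.2 - p‖) hT ⟨_, h1T⟩
  have hmin' : ∀ v ∈ reflectionGroup P, ∀ r ∈ dualRootLattice b,
      ‖w x + q - p‖ ≤ ‖v x + r - p‖ := by
    intro v hv r hr
    by_cases hrR : ‖r‖ ≤ R
    · exact hmin (v, r) ⟨hv, hr, hrR⟩
    · have h1 : ‖w x + q - p‖ ≤ ‖x - p‖ := by simpa using hmin _ h1T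
      have h2 : ‖r‖ ≤ ‖v x + r - p‖ + ‖v x‖ + ‖p‖ := by
        calc ‖r‖ = ‖(v x + r - p) - v x + p‖ := by congr 1; abel
          _ ≤ ‖(v x + r - p) - v x‖ + ‖p‖ := norm_add_le _ _
          _ ≤ _ := by gcongr; exact norm_sub_le _ _
      rw [norm_map hP hv] at h2
      have h3 : ‖x - p‖ + ‖x‖ + ‖p‖ < ‖r‖ := not_le.1 hrR
      linarith
  refine ⟨w, hw, q, hq, (mem_fundDomain_iff b _).2 fun α hα ↦ ?_⟩
  have hα0 := hp α hα
  have h1 := hmin' (P.reflection α.1 * w) (mul_mem (reflection_mem_reflectionGroup P _) hw)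
    (P.reflection α.1 q - α.2 • P.coroot α.1)
    (sub_mem (map_mem_dualRootLattice hP b (reflection_mem_reflectionGroup P _) hq)
      (zsmul_mem (coroot_mem_dualRootLattice b _) _))
  have h2 : (P.reflection α.1 * w) x + (P.reflection α.1 q - α.2 • P.coroot α.1) =
      affineReflection hP α (w x + q) := by
    rw [affineReflection_eq_reflection_sub, map_add, LinearEquiv.mul_apply]
    abel
  rw [h2] at h1
  have h3 := norm_affineReflection_sub_sq hP α (w x + q) p
  have h4 : ‖w x + q - p‖ ^ 2 ≤ ‖affineReflection hP α (w x + q) - p‖ ^ 2 := by gcongr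
  have h5 := div_pos four_pos (IsEuclidean.inner_root_self_pos P α.1)
  -- If `α` were negative at the nearest point, its reflection would give a point of the orbit still
  -- nearer to `p`.
  by_contra! hneg
  have h6 := mul_pos h5 (mul_pos_of_neg_of_neg (neg_neg_of_pos hα0) hneg)
  nlinarith

/-- Finitely many strict inequalities define an open set. Conversely, moving along `-α^∨` lowers `α`
at rate 2, so a point where `α` is not positive has points outside `F` arbitrarily near. -/
theorem affineEval_pos_iff_mem_interior (hP : IsEuclidean P) (b : P.Base) (x : V) :
    x ∈ interior (fundDomain b) ↔ ∀ α, IsSimpleAffine b α → 0 < affineEval P α x := by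
  have hcont (α : ι × ℤ) : Continuous (affineEval P α) := by
    unfold affineEval
    fun_prop
  constructor
  · intro hx α hα
    by_contra! hneg
    have hc : Filter.Tendsto (fun t : ℝ ↦ x - t • P.coroot α.1) (nhdsWithin 0 (Set.Ioi 0))
        (nhds x) := by
      have : Continuous fun t : ℝ ↦ x - t • P.coroot α.1 := by fun_prop
      simpa using (this.tendsto 0).mono_left nhdsWithin_le_nhds
    obtain ⟨t, htF, ht⟩ := ((hc.eventually (mem_interior_iff_mem_nhds.1 hx)).and
      self_mem_nhdsWithin).exists
    have h1 := (mem_fundDomain_iff b _).1 htF α hα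
    have h2 : affineEval P α (x - t • P.coroot α.1) = affineEval P α x - 2 * t := by
      rw [affineEval, affineEval, inner_sub_left, inner_smul_left, hP.inner_coroot_root_self]
      simp only [conj_trivial]
      ring
    have : (0 : ℝ) < t := ht
    linarith
  · intro h
    have hfin : {α : ι × ℤ | IsSimpleAffine b α}.Finite := by
      refine ((b.support.finite_toSet.prod (Set.finite_singleton 0)).union
        (Set.finite_singleton (affineSimple b))).subset ?_
      rintro α (hα | hα)
      · exact Or.inl hα
      · exact Or.inr hα
    have hopen : IsOpen (⋂ α ∈ {α : ι × ℤ | IsSimpleAffine b α}, {y | 0 < affineEval P α y}) :=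
      hfin.isOpen_biInter fun α _ ↦ isOpen_lt continuous_const (hcont α)
    refine interior_maximal ?_ hopen (Set.mem_iInter₂.2 h)
    exact fun y hy ↦ (mem_fundDomain_iff b y).2 fun α hα ↦ (Set.mem_iInter₂.1 hy α hα).le

variable [P.IsIrreducible] [P.IsReduced]

theorem reflection_toEquiv_mem_simpleAffineGroup (hP : IsEuclidean P) (b : P.Base) (i : ι) :
    (P.reflection i).toEquiv ∈ simpleAffineGroup hP b := by
  have key (j : ι) (hj : b.IsPos j) : (P.reflection j).toEquiv ∈ simpleAffineGroup hP b := by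
    have h := affineReflection_mem hP (β := (j, 0)) (Or.inr ⟨rfl, hj⟩)
    convert h using 1
    ext x
    rw [affineReflection_eq_reflection_sub]
    simp
  rcases RootPairing.Base.IsPos.or_neg b i with hi | hi
  · exact key i hi
  · have h : P.reflection (P.reflectionPerm i i) = P.reflection i := by
      ext x
      simp [RootPairing.reflection_reflectionPerm]
    rw [← h]
    exact key _ hi

theorem toEquiv_mem_simpleAffineGroup (hP : IsEuclidean P) (b : P.Base) {w : V ≃ₗ[ℝ] V}
    (hw : w ∈ reflectionGroup P) : w.toEquiv ∈ simpleAffineGroup hP b :=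
  reflectionGroup_induction (P := P) (p := fun w ↦ w.toEquiv ∈ simpleAffineGroup hP b)
    (one_mem (simpleAffineGroup hP b))
    (fun i _ h ↦ mul_mem (reflection_toEquiv_mem_simpleAffineGroup hP b i) h) hw

/-- Translation by a coroot is the product of the reflections in two parallel hyperplanes. -/
theorem addRight_mem_simpleAffineGroup (hP : IsEuclidean P) (b : P.Base) {q : V}
    (hq : q ∈ dualRootLattice b) : Equiv.addRight q ∈ simpleAffineGroup hP b := by
  induction hq using AddSubgroup.closure_induction with
  | mem q hq =>
    obtain ⟨j, hj, rfl⟩ := hq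
    have hpos := b.isPos_of_mem_support hj
    have h0 := affineReflection_mem hP (β := (j, 0)) (Or.inr ⟨rfl, hpos⟩)
    have h1 := affineReflection_mem hP (b := b) (β := (j, 1)) (Or.inl one_pos)
    convert mul_mem h0 h1 using 1
    ext x
    rw [Equiv.Perm.mul_apply, affineReflection_eq_reflection_sub,
      affineReflection_eq_reflection_sub]
    have h2 : P.reflection j (P.coroot j) = -P.coroot j := by
      rw [← hP.coreflection_eq, P.coreflection_apply_self]
    simp [h2]
  | zero => simp
  | add x y _ _ hx hy =>
    convert mul_mem hy hx using 1
    ext z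
    simp [add_assoc]
  | neg x _ hx =>
    convert inv_mem hx using 1
    ext z
    simp

/-- Every orbit of the affine Weyl group meets `F` at most once, and the stabilizers of interior
points are trivial. -/
theorem map_add_eq_self (hP : IsEuclidean P) (b : P.Base) {x q : V} {w : V ≃ₗ[ℝ] V}
    (hw : w ∈ reflectionGroup P) (hq : q ∈ dualRootLattice b) (hx : x ∈ fundDomain b)
    (hwx : w x + q ∈ fundDomain b) :
    w x + q = x ∧ (x ∈ interior (fundDomain b) → LinearEquiv.det w = 1) := by
  obtain ⟨l, hl, hlw⟩ := exists_affineWord_eq hP (mul_mem (addRight_mem_simpleAffineGroup hP b hq)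
    (toEquiv_mem_simpleAffineGroup hP b hw))
  have happ (y : V) : affineWord hP l y = w y + q := by rw [hlw]; rfl
  obtain ⟨h1, h2⟩ := affineWord_apply_eq_self hP hx hl (by rwa [happ])
  refine ⟨(happ x).symm.trans h1, fun hint ↦ ?_⟩
  have h3 := h2 ((affineEval_pos_iff_mem_interior hP b x).1 hint)
  have h4 (y : V) : w y + q = y := by rw [← happ, h3]; rfl
  have hq0 : q = 0 := by simpa using h4 0
  have hw1 : w = 1 := by
    ext y
    simpa [hq0] using h4 y
  rw [hw1, map_one]

/-- Every orbit of the even affine Weyl group meets `F^e`. -/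
theorem exists_map_add_mem_evenFundDomain (hP : IsEuclidean P) (b : P.Base) (j : ι) (x : V) :
    ∃ w ∈ evenGroup P, ∃ q ∈ dualRootLattice b, w x + q ∈ evenFundDomain b j := by
  obtain ⟨w, hw, q, hq, h⟩ := exists_map_add_mem_fundDomain hP b x
  by_cases hdet : LinearEquiv.det w = 1
  · exact ⟨w, ⟨hw, hdet⟩, q, hq, Or.inl h⟩
  have hmem (i : ι) := reflection_mul_mem_evenGroup hP b hw hdet i
  have hrq (i : ι) := map_mem_dualRootLattice hP b (reflection_mem_reflectionGroup P i) hq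
  -- Here `w` is odd. An interior point is carried by `r_j` into the second piece of `F^e`; a
  -- boundary point is fixed by the reflection in a wall through it, which makes the element even.
  by_cases hint : w x + q ∈ interior (fundDomain b)
  · exact ⟨_, hmem j, _, hrq j, Or.inr ⟨_, hint, by rw [map_add]; rfl⟩⟩
  · rw [affineEval_pos_iff_mem_interior hP] at hint
    push Not at hint
    obtain ⟨α, hα, hle⟩ := hint
    have h0 : affineEval P α (w x + q) = 0 :=
      le_antisymm hle ((mem_fundDomain_iff b _).1 h α hα)
    refine ⟨_, hmem α.1, P.reflection α.1 q - α.2 • P.coroot α.1,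
      sub_mem (hrq α.1) (zsmul_mem (coroot_mem_dualRootLattice b _) _), Or.inl ?_⟩
    have h1 := affineReflection_eq_self hP h0
    rw [affineReflection_eq_reflection_sub, map_add, ← LinearEquiv.mul_apply, add_sub_assoc] at h1
    rwa [h1]

/-- Every orbit of the even affine Weyl group meets `F^e` at most once. -/
theorem map_add_eq_self_of_mem_evenFundDomain (hP : IsEuclidean P) (b : P.Base) (j : ι) {x q : V}
    {w : V ≃ₗ[ℝ] V} (hw : w ∈ evenGroup P) (hq : q ∈ dualRootLattice b)
    (hx : x ∈ evenFundDomain b j) (hwx : w x + q ∈ evenFundDomain b j) : w x + q = x := by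
  obtain ⟨hw, hdet⟩ := hw
  replace hdet : LinearEquiv.det w = 1 := hdet
  have hr := reflection_mem_reflectionGroup P j
  have hne : ((-1 : ℝˣ)) ≠ 1 := by
    intro h
    have := congrArg Units.val h
    norm_num at this
  -- Undoing `r_j` brings both points into `F`. When they lie in different pieces, the connecting
  -- element becomes odd while an interior point is involved, contradicting `map_add_eq_self`.
  rcases hx with hx | ⟨x, hx, rfl⟩ <;> rcases hwx with hy | ⟨y, hy, hxy⟩
  · exact (map_add_eq_self hP b hw hq hx hy).1
  · have hy' : y = (P.reflection j * w) x + P.reflection j q := by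
      rw [LinearEquiv.mul_apply, ← map_add, ← hxy, P.reflection_same]
    obtain ⟨h1, h2⟩ := map_add_eq_self hP b (mul_mem hr hw) (map_mem_dualRootLattice hP b hr hq) hx
      (hy' ▸ interior_subset hy)
    have h3 := h2 (by rwa [← h1, ← hy'])
    rw [map_mul, det_reflection hP b, hdet, mul_one] at h3
    exact absurd h3 hne
  · have h3 := (map_add_eq_self hP b (mul_mem hw hr) hq (interior_subset hx) hy).2 hx
    rw [map_mul, det_reflection hP b, hdet, one_mul] at h3
    exact absurd h3 hne
  · have hy' : y = (P.reflection j * w * P.reflection j) x + P.reflection j q := by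
      rw [LinearEquiv.mul_apply, LinearEquiv.mul_apply, ← map_add, ← hxy, P.reflection_same]
    have h1 := (map_add_eq_self hP b (mul_mem (mul_mem hr hw) hr)
      (map_mem_dualRootLattice hP b hr hq) (interior_subset hx) (hy' ▸ interior_subset hy)).1
    rw [← hxy, hy', h1]

end FundamentalDomain

/-! ### The pairing modulo integers -/

section Pairing

variable {V : Type*} [NormedAddCommGroup V] [InnerProductSpace ℝ V]

/-- The inner product modulo integers, as a homomorphism. -/
noncomputable def innerMod (L L' : AddSubgroup V) : L →+ L' →+ AddCircle (1 : ℝ) :=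
  AddMonoidHom.mk' (fun a ↦ AddMonoidHom.mk' (fun b ↦ ((inner ℝ (a : V) (b : V) : ℝ) : AddCircle (1 : ℝ)))
    fun b c ↦ by rw [AddSubgroup.coe_add, inner_add_right, AddCircle.coe_add]) fun a c ↦ by
      ext b
      change ((inner ℝ ((a + c : L) : V) (b : V) : ℝ) : AddCircle (1 : ℝ)) = _
      rw [AddSubgroup.coe_add, inner_add_left, AddCircle.coe_add]
      rfl

theorem coe_eq_zero_iff_exists_int {x : ℝ} :
    ((x : ℝ) : AddCircle (1 : ℝ)) = 0 ↔ ∃ k : ℤ, x = k := by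
  rw [AddCircle.coe_eq_zero_iff]
  simp [eq_comm]

/-- The pairing of `L ⧸ K` and `L' ⧸ K'` induced by the inner product. -/
noncomputable def innerPairing {L K L' K' : AddSubgroup V}
    (h : ∀ a ∈ L, ∀ b ∈ K', ∃ k : ℤ, inner ℝ a b = k)
    (h' : ∀ a ∈ K, ∀ b ∈ L', ∃ k : ℤ, inner ℝ a b = k) :
    L ⧸ K.addSubgroupOf L →+ L' ⧸ K'.addSubgroupOf L' →+ AddCircle (1 : ℝ) :=
  QuotientAddGroup.lift _ (AddMonoidHom.mk'
    (fun a ↦ QuotientAddGroup.lift _ (innerMod L L' a) fun b hb ↦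
      coe_eq_zero_iff_exists_int.2 (h a a.2 b hb))
    fun a c ↦ by
      ext b
      change innerMod L L' (a + c) b = innerMod L L' a b + innerMod L L' c b
      rw [map_add]
      rfl) fun a ha ↦ by
        ext b
        exact coe_eq_zero_iff_exists_int.2 (h' a ha b b.2)

end Pairing

end EvenGrid

/-! ### The main theorem -/

open EvenGrid in
theorem mainTheorem5 {ι V : Type*} [Finite ι] [Nonempty ι]
    [NormedAddCommGroup V] [InnerProductSpace ℝ V]
    (P : RootPairing ι ℝ V V) [P.IsRootSystem] [P.IsCrystallographic] [P.IsReduced]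
    [P.IsIrreducible] (hP : EvenGrid.IsEuclidean P)
    (b : P.Base) (j j' : ι) (hj : j ∈ b.support) (hj' : j' ∈ b.support)
    (M : ℕ) (hM : 0 < M) :
    (EvenGrid.pointGrid b j M).Finite ∧ (EvenGrid.weightGrid b j' M).Finite ∧
      (EvenGrid.pointGrid b j M).ncard = (EvenGrid.weightGrid b j' M).ncard := by
  have hM0 : (0 : ℝ) < M := by exact_mod_cast hM
  let G := evenGroup P
  let W := reflectionGroup P
  have hGW : G ≤ W := inf_le_left
  have hWfin : Finite W := finite_reflectionGroup b
  have hGfin : Finite G := Finite.of_injective _ (Subgroup.inclusion_injective hGW)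
  have hWflip {w : V ≃ₗ[ℝ] V} (hw : w ∈ W) : w ∈ reflectionGroup P.flip := by
    rwa [reflectionGroup_flip hP]
  -- invariance of the four lattices
  have hL : ∀ g : W, ∀ x ∈ refinedLattice b M, g • x ∈ refinedLattice b M := by
    rintro g _ ⟨x, hx, rfl⟩
    exact ⟨g.1 x, map_mem_dualWeightLattice hP b g.2 hx, (map_smul g.1 (M : ℝ)⁻¹ x).symm⟩
  have hK : ∀ g : W, ∀ x ∈ dualRootLattice b, g • x ∈ dualRootLattice b :=
    fun g x hx ↦ map_mem_dualRootLattice hP b g.2 hx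
  have hL' : ∀ g : W, ∀ x ∈ weightLattice b, g • x ∈ weightLattice b :=
    fun g x hx ↦ map_mem_dualWeightLattice hP.flip b.flip (hWflip g.2) hx
  have hK' : ∀ g : W, ∀ x ∈ (M : ℝ) • rootLattice b, g • x ∈ (M : ℝ) • rootLattice b := by
    rintro g _ ⟨x, hx, rfl⟩
    exact ⟨g.1 x, map_mem_dualRootLattice hP.flip b.flip (hWflip g.2) hx,
      (map_smul g.1 (M : ℝ) x).symm⟩
  have hKL : dualRootLattice b ≤ refinedLattice b M := fun x hx ↦
    ⟨(M : ℝ) • x, by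
      change (M : ℝ) • x ∈ dualWeightLattice b
      rw [Nat.cast_smul_eq_nsmul]
      exact nsmul_mem (dualRootLattice_le hP b hx) M, inv_smul_smul₀ hM0.ne' x⟩
  have hKL' : (M : ℝ) • rootLattice b ≤ weightLattice b := by
    rintro _ ⟨x, hx, rfl⟩
    change (M : ℝ) • x ∈ weightLattice b
    rw [Nat.cast_smul_eq_nsmul]
    exact nsmul_mem (dualRootLattice_le hP.flip b.flip hx) M
  -- finiteness of the quotients
  have hA : Finite (RefinedQuotient b M) := by
    refine finite_quotient_of_forall_exists hL hK hKL (S := fundDomain b) ?_ fun x _ ↦ ?_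
    · refine finite_of_inner_root_mem b (c := M) (R := 1) hM0 ?_ ?_
      · rintro _ ⟨⟨x, hx, rfl⟩, -⟩ i hi
        obtain ⟨k, hk⟩ := hx i hi
        refine ⟨k, ?_⟩
        change (M : ℝ) * inner ℝ ((M : ℝ)⁻¹ • x) (P.root i) = k
        rw [inner_smul_left, hk, conj_trivial, mul_inv_cancel_left₀ hM0.ne']
      · rintro x ⟨-, hx⟩ i hi
        rw [abs_of_nonneg (hx.1 i hi)]
        exact inner_root_le_one hP hx i
    · obtain ⟨w, hw, q, hq, h⟩ := exists_map_add_mem_fundDomain hP b x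
      exact ⟨⟨w, hw⟩, q, hq, h⟩
  have hB : Finite (WeightQuotient b M) := by
    refine finite_quotient_of_forall_exists hL' hK' hKL' (S := (M : ℝ) • fundDomain b.flip)
      ?_ fun x _ ↦ ?_
    · refine finite_of_inner_root_mem b.flip (c := 1) (R := M) one_pos ?_ ?_
      · rintro x ⟨hx, -⟩ i hi
        rw [one_mul]
        exact hx i hi
      · rintro _ ⟨-, x, hx, rfl⟩ i hi
        change |inner ℝ ((M : ℝ) • x) (P.flip.root i)| ≤ M
        rw [inner_smul_left, conj_trivial, abs_of_nonneg (mul_nonneg hM0.le (hx.1 i hi))]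
        exact mul_le_of_le_one_right hM0.le (inner_root_le_one hP.flip hx i)
    · obtain ⟨w, hw, q, hq, h⟩ := exists_map_add_mem_fundDomain hP.flip b.flip ((M : ℝ)⁻¹ • x)
      rw [reflectionGroup_flip hP] at hw
      refine ⟨⟨w, hw⟩, (M : ℝ) • q, ⟨q, hq, rfl⟩, _, h, ?_⟩
      change (M : ℝ) • (w ((M : ℝ)⁻¹ • x) + q) = w x + (M : ℝ) • q
      rw [smul_add, map_smul, smul_inv_smul₀ hM0.ne']
  refine ⟨Set.toFinite _, Set.toFinite _, ?_⟩
  have hLG : ∀ g : G, ∀ x ∈ refinedLattice b M, g • x ∈ refinedLattice b M :=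
    fun g ↦ hL ⟨g, hGW g.2⟩
  have hKG : ∀ g : G, ∀ x ∈ dualRootLattice b, g • x ∈ dualRootLattice b :=
    fun g ↦ hK ⟨g, hGW g.2⟩
  have hLG' : ∀ g : G, ∀ x ∈ weightLattice b, g • x ∈ weightLattice b :=
    fun g ↦ hL' ⟨g, hGW g.2⟩
  have hKG' : ∀ g : G, ∀ x ∈ (M : ℝ) • rootLattice b, g • x ∈ (M : ℝ) • rootLattice b :=
    fun g ↦ hK' ⟨g, hGW g.2⟩
  let iA := quotientAction hLG hKG
  let iB := quotientAction hLG' hKG'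
  -- the grids represent the orbits
  have hpoint : (pointGrid b j M).ncard =
      Nat.card (MulAction.orbitRel.Quotient G (RefinedQuotient b M)) := by
    refine ncard_cosetsMeeting hLG hKG hKL (S := evenFundDomain b j) (fun x _ ↦ ?_) ?_
    · obtain ⟨w, hw, q, hq, h⟩ := exists_map_add_mem_evenFundDomain hP b j x
      exact ⟨⟨w, hw⟩, q, hq, h⟩
    · exact fun x hx g k hk h ↦ map_add_eq_self_of_mem_evenFundDomain hP b j g.2 hk hx h
  -- The dual region is the primal one for `P.flip`, since `r_j'` is the same map for both systems.
  have hdual : dualEvenFundDomain b j' = evenFundDomain b.flip j' := by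
    have h : P.flip.reflection j' = P.reflection j' := hP.coreflection_eq j'
    rw [evenFundDomain, h]
    rfl
  have hweight : (weightGrid b j' M).ncard =
      Nat.card (MulAction.orbitRel.Quotient G (WeightQuotient b M)) := by
    refine ncard_cosetsMeeting hLG' hKG' hKL' (S := (M : ℝ) • dualEvenFundDomain b j')
      (fun x _ ↦ ?_) ?_
    · obtain ⟨w, hw, q, hq, h⟩ :=
        exists_map_add_mem_evenFundDomain hP.flip b.flip j' ((M : ℝ)⁻¹ • x)
      rw [evenGroup_flip hP] at hw
      refine ⟨⟨w, hw⟩, (M : ℝ) • q, ⟨q, hq, rfl⟩, _, hdual ▸ h, ?_⟩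
      change (M : ℝ) • (w ((M : ℝ)⁻¹ • x) + q) = w x + (M : ℝ) • q
      rw [smul_add, map_smul, smul_inv_smul₀ hM0.ne']
    · rintro _ ⟨x, hx, rfl⟩ g _ ⟨k, hk, rfl⟩ h
      have heq : g • (M : ℝ) • x + (M : ℝ) • k = (M : ℝ) • (g.1 x + k) := by
        rw [smul_add, ← map_smul]
        rfl
      change g • (M : ℝ) • x + (M : ℝ) • k = (M : ℝ) • x
      change g • (M : ℝ) • x + (M : ℝ) • k ∈ _ at h
      rw [heq, Set.smul_mem_smul_set_iff₀ hM0.ne', hdual] at h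
      rw [heq, map_add_eq_self_of_mem_evenFundDomain hP.flip b.flip j'
        ((evenGroup_flip hP).symm ▸ g.2) hk (hdual ▸ hx) h]
  rw [hpoint, hweight]
  -- the duality
  have hscale {x y : V} : inner ℝ ((M : ℝ)⁻¹ • x) ((M : ℝ) • y) = inner ℝ x y := by
    rw [inner_smul_left, inner_smul_right, conj_trivial, inv_mul_cancel_left₀ hM0.ne']
  have hLK' : ∀ x ∈ refinedLattice b M, ∀ y ∈ (M : ℝ) • rootLattice b,
      ∃ k : ℤ, inner ℝ x y = k := by
    rintro _ ⟨x, hx, rfl⟩ _ ⟨y, hy, rfl⟩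
    obtain ⟨k, hk⟩ := inner_dualWeight_root b hx hy
    exact ⟨k, hscale.trans hk⟩
  have hKL'' : ∀ x ∈ dualRootLattice b, ∀ y ∈ weightLattice b, ∃ k : ℤ, inner ℝ x y = k := by
    intro x hx y hy
    rw [real_inner_comm]
    exact inner_weight_dualRoot b hy hx
  refine card_orbits_eq_of_pairing (innerPairing hLK' hKL'') ?_ ?_ ?_
  · rintro g ⟨x⟩ ⟨y⟩
    exact congrArg ((↑) : ℝ → AddCircle (1 : ℝ)) (inner_map_map hP (hGW g.2) x.1 y.1)
  -- Nondegeneracy on the left is the duality of `Q^∨` with `P`, obtained from `P.flip`; on the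
  -- right it is the duality of `Q` with `P^∨` after moving the factor `1/M` across the inner
  -- product.
  · rintro ⟨x⟩ h
    refine (QuotientAddGroup.eq_zero_iff x).2
      (mem_rootLattice_of_forall_inner hP.flip b.flip fun y hy ↦ ?_)
    rw [real_inner_comm]
    exact coe_eq_zero_iff_exists_int.1 (h (QuotientAddGroup.mk ⟨y, hy⟩))
  · rintro ⟨y⟩ h
    refine (QuotientAddGroup.eq_zero_iff y).2 ⟨(M : ℝ)⁻¹ • y.1,
      mem_rootLattice_of_forall_inner hP b fun x hx ↦ ?_, smul_inv_smul₀ hM0.ne' y.1⟩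
    obtain ⟨k, hk⟩ := coe_eq_zero_iff_exists_int.1
      (h (QuotientAddGroup.mk ⟨(M : ℝ)⁻¹ • x, ⟨x, hx, rfl⟩⟩))
    refine ⟨k, ?_⟩
    rw [← hk, inner_smul_left, inner_smul_right, conj_trivial]
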